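/- **Conventions.** Let $Z$ be a topological space and $Y\subset Z$. $K(Z,Y)$ is the set of classes $[E_0,E_1,a]$ of triples consisting of complex vector bundles $E_0,E_1$ over $Z$ (of locally constant finite rank) and a bundle morphism $a:E_0\to E_1$ whose support $\{z : a_z \text{ is not an isomorphism}\}$ is a compact subset of $Z\setminus Y$. Two triples $\xi,\xi'$ are equivalent if there are triples $\eta_0,\eta_1$ with empty support such that $\xi\oplus\eta_0$ and $\xi'\oplus\eta_1$ are homotopic, i.e. isomorphic to the restrictions to $Z\times\{0\}$ and $Z\times\{1\}$ of one such triple on $(Z\times[0,1],Y\times[0,1])$. Set $K^{-1}(X,Y)=K(X\times\mathbb R,Y\times\mathbb R)$. Let $T:Z\to\mathcal L(W,F)$ be a norm continuous family of Fredholm operators of index $0$ between Banach spaces, invertible on $Y$ and outside a compact subset of $Z$. Then $\operatorname{ind}(T)=[E(T,V),Z\times V,T|_{E(T,V)}]\in K(Z,Y)$, where $V\subset F$ is any finite dimensional subspace with $\operatorname{im}T_z+V=F$ for all $z$, and $E(T,V)\subset Z\times W$ is the bundle with fibres $\{u\in W: T_zu\in V\}$ (the class does not depend on $V$). Let $W,H$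 be complex Hilbert spaces with a continuous dense injection $W\hookrightarrow H$, $X$ a compact space, $Y\subset X$ closed. A *selfadjoint Fredholm family* $D:X\to\mathcal L(W,H)$, invertible on $Y$, is a norm continuous family of Fredholm operators which are selfadjoint as operators in $H$ with domain $W$ and are invertible for $\lambda\in Y$. Its index bundle is $\operatorname{s-ind}(D)=\operatorname{ind}(\overline D)\in K^{-1}(X,Y)$, with $\overline D_{(\lambda,s)}=D_\lambda+is$ for $(\lambda,s)\in X\times\mathbb R$. **Theorem.** Let $W\subset E\subset H$ be complex Hilbert spaces such that $W\hookrightarrow E$ is continuous with dense image, $E\hookrightarrow H$ is compact, and $W$ is dense in $H$. Let $K:H\to E$ be given by $\langle u,v\rangle_H=\langle Ku,v\rangle_E$ for $u\in H$, $v\in E$, let $K_0=K|_E$, and assume $W\subset\operatorname{im}K$. Let $X$ be a compact space, $Y\subset X$ closed, and $D:X\to\mathcal L(W,H)$ a selfadjoint Fredholm family, invertible on $Y$, such that for some $C>0$ $$|\langle D_\lambda u,v\rangle_H|\le C\|u\|_E\|v\|_E,\qquad u,v\in W,\ \lambda\in X.$$ Let $B_\lambda$ be the bounded operators on $E$ representing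 the unique bounded extensions to $E$ of the forms $\langle D_\lambda u,v\rangle_H$, i.e. $\langle B_\lambda u,v\rangle_E=\langle D_\lambda u,v\rangle_H$ for $u,v\in W$. Assume that $\lambda\mapsto B_\lambda$ is a norm continuous family of Fredholm operators on $E$ and that $$\ker(B_\lambda+is\,K_0)\subset W,\qquad(\lambda,s)\in X\times\mathbb R.$$ Then $B$ is a selfadjoint Fredholm family on $E$ (with domain $E$), invertible on $Y$, and $$\operatorname{s-ind}(D)=\operatorname{s-ind}(B)\in K^{-1}(X,Y).$$ -/

import Mathlib

open Topology Bundle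

universe u v

namespace IndexBundle

/-! ### Complex vector bundles and bundle morphisms -/

/-- A complex vector bundle over `Z`: a family of complex vector spaces with a topology on the
total space which is locally isomorphic, linearly on the fibres, to `U × ℂⁿ`.
The rank `n` may depend on the point (so it is only locally constant). -/
structure CBundle (Z : Type v) [TopologicalSpace Z] where
  Fiber : Z → Type u
  [addCommGroup : ∀ z, AddCommGroup (Fiber z)]
  [module : ∀ z, Module ℂ (Fiber z)]
  [topTotal : TopologicalSpace (TotalSpace Unit Fiber)]
  locallyTrivial : ∀ z₀ : Z, ∃ (n : ℕ)
    (e : Trivialization (Fin n → ℂ) (TotalSpace.proj : TotalSpace Unit Fiber → Z)),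
    z₀ ∈ e.baseSet ∧
      ∀ z ∈ e.baseSet, IsLinearMap ℂ (fun u : Fiber z => (e ⟨z, u⟩).2)

attribute [instance] CBundle.addCommGroup CBundle.module CBundle.topTotal

section

variable {Z : Type v} [TopologicalSpace Z]

/-- The total space of a bundle. -/
abbrev CBundle.Total (E : CBundle.{u} Z) : Type (max u v) := TotalSpace Unit E.Fiber

/-- A criterion for local triviality: local trivialisations with an arbitrary finite dimensional
normed space as model fibre, given by fibrewise inverse linear maps. -/
theorem exists_trivialization {Fiber : Z → Type u} [∀ z, AddCommGroup (Fiber z)]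
    [∀ z, Module ℂ (Fiber z)] [TopologicalSpace (TotalSpace Unit Fiber)]
    (hproj : Continuous (TotalSpace.proj : TotalSpace Unit Fiber → Z))
    {F : Type*} [NormedAddCommGroup F] [NormedSpace ℂ F] [FiniteDimensional ℂ F]
    {U : Set Z} (hU : IsOpen U) (φ : ∀ z, Fiber z →ₗ[ℂ] F) (ψ : ∀ z, F → Fiber z)
    (hl : ∀ z ∈ U, ∀ u, ψ z (φ z u) = u) (hr : ∀ z ∈ U, ∀ f, φ z (ψ z f) = f)
    (hφ : ContinuousOn (fun p : TotalSpace Unit Fiber => φ p.proj p.2) (TotalSpace.proj ⁻¹' U))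
    (hψ : ContinuousOn (fun q : Z × F => (⟨q.1, ψ q.1 q.2⟩ : TotalSpace Unit Fiber))
      (U ×ˢ Set.univ))
    (z₀ : Z) (hz₀ : z₀ ∈ U) :
    ∃ (n : ℕ) (e : Trivialization (Fin n → ℂ) (TotalSpace.proj : TotalSpace Unit Fiber → Z)),
      z₀ ∈ e.baseSet ∧ ∀ z ∈ e.baseSet, IsLinearMap ℂ (fun u : Fiber z => (e ⟨z, u⟩).2) := by
  let c : F ≃L[ℂ] (Fin (Module.finrank ℂ F) → ℂ) :=
    ContinuousLinearEquiv.ofFinrankEq (by simp)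
  refine ⟨Module.finrank ℂ F,
    { toFun := fun p => (p.proj, c (φ p.proj p.2))
      invFun := fun q => ⟨q.1, ψ q.1 (c.symm q.2)⟩
      source := TotalSpace.proj ⁻¹' U
      target := U ×ˢ Set.univ
      map_source' := fun p hp => ⟨hp, trivial⟩
      map_target' := fun q hq => hq.1
      left_inv' := ?_
      right_inv' := ?_
      open_source := hU.preimage hproj
      open_target := hU.prod isOpen_univ
      continuousOn_toFun := ?_
      continuousOn_invFun := ?_
      baseSet := U
      open_baseSet := hU
      source_eq := rfl
      target_eq := rfl
      proj_toFun := fun p _ => rfl }, hz₀, ?_⟩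
  · rintro ⟨z, u⟩ hz
    simp [hl z hz u]
  · rintro ⟨z, f⟩ hz
    simp [hr z hz.1]
  · exact hproj.continuousOn.prodMk (c.continuous.comp_continuousOn hφ)
  · refine hψ.comp (f := fun q : Z × (Fin (Module.finrank ℂ F) → ℂ) => (q.1, c.symm q.2))
      (by fun_prop) ?_
    rintro ⟨z, f⟩ hz
    exact ⟨hz.1, trivial⟩
  · intro z _
    exact (c.toLinearMap.comp (φ z)).isLinear

/-- A morphism of vector bundles over the identity of `Z`. -/
structure CBundle.Hom (E E' : CBundle.{u} Z) where
  map : ∀ z, E.Fiber z →ₗ[ℂ] E'.Fiber z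
  continuous_map : Continuous (fun p : E.Total => (⟨p.proj, map p.proj p.2⟩ : E'.Total))

/-- An isomorphism of vector bundles over the identity of `Z`. -/
structure CBundle.Iso (E E' : CBundle.{u} Z) where
  equiv : ∀ z, E.Fiber z ≃ₗ[ℂ] E'.Fiber z
  continuous_equiv : Continuous (fun p : E.Total => (⟨p.proj, equiv p.proj p.2⟩ : E'.Total))
  continuous_symm :
    Continuous (fun p : E'.Total => (⟨p.proj, (equiv p.proj).symm p.2⟩ : E.Total))

theorem CBundle.continuous_proj (E : CBundle.{u} Z) :
    Continuous (TotalSpace.proj : E.Total → Z) := by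
  rw [continuous_iff_continuousAt]
  intro p
  obtain ⟨n, e, he, -⟩ := E.locallyTrivial p.proj
  exact e.continuousAt_proj (e.mem_source.2 he)

/-- Local triviality in terms of fibrewise inverse linear maps. -/
theorem CBundle.exists_local (E : CBundle.{u} Z) (z₀ : Z) :
    ∃ (n : ℕ) (U : Set Z) (φ : ∀ z, E.Fiber z →ₗ[ℂ] (Fin n → ℂ))
      (ψ : ∀ z, (Fin n → ℂ) → E.Fiber z), IsOpen U ∧ z₀ ∈ U ∧
      (∀ z ∈ U, ∀ u, ψ z (φ z u) = u) ∧ (∀ z ∈ U, ∀ f, φ z (ψ z f) = f) ∧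
      ContinuousOn (fun p : E.Total => φ p.proj p.2) (TotalSpace.proj ⁻¹' U) ∧
      ContinuousOn (fun q : Z × (Fin n → ℂ) => (⟨q.1, ψ q.1 q.2⟩ : E.Total))
        (U ×ˢ Set.univ) := by
  classical
  obtain ⟨n, e, he, hlin⟩ := E.locallyTrivial z₀
  have hfst : ∀ z ∈ e.baseSet, ∀ u : E.Fiber z, (e ⟨z, u⟩).1 = z := fun z hz u =>
    e.coe_fst (e.mem_source.2 hz)
  have hsurj : ∀ z ∈ e.baseSet, ∀ f, ∃ u : E.Fiber z, (e ⟨z, u⟩).2 = f := by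
    intro z hz f
    have h1 : e.toOpenPartialHomeomorph.symm (z, f) ∈ e.source :=
      e.map_target (e.mem_target.2 hz)
    have h2 : e (e.toOpenPartialHomeomorph.symm (z, f)) = (z, f) :=
      e.apply_symm_apply (e.mem_target.2 hz)
    have h3 : (e.toOpenPartialHomeomorph.symm (z, f)).proj = z :=
      e.proj_symm_apply (e.mem_target.2 hz)
    generalize e.toOpenPartialHomeomorph.symm (z, f) = p at h1 h2 h3
    obtain ⟨z', u⟩ := p
    subst h3
    exact ⟨u, by rw [h2]⟩
  choose g hg using hsurj
  have hginv : ∀ z (hz : z ∈ e.baseSet) f,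
      (⟨z, g z hz f⟩ : E.Total) = e.toOpenPartialHomeomorph.symm (z, f) := by
    intro z hz f
    have h1 : e ⟨z, g z hz f⟩ = (z, f) := Prod.ext (hfst z hz _) (hg z hz f)
    rw [← h1]
    exact (e.toOpenPartialHomeomorph.left_inv (e.mem_source.2 hz)).symm
  refine ⟨n, e.baseSet, fun z => if h : z ∈ e.baseSet then (hlin z h).mk' _ else 0,
    fun z f => if h : z ∈ e.baseSet then g z h f else 0,
    e.open_baseSet, he, ?_, ?_, ?_, ?_⟩
  · intro z hz u
    simp only [hz, dif_pos, IsLinearMap.mk'_apply]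
    have h1 : (⟨z, g z hz (e ⟨z, u⟩).2⟩ : E.Total) = ⟨z, u⟩ := by
      rw [hginv]
      have h2 : (z, (e ⟨z, u⟩).2) = e ⟨z, u⟩ := Prod.ext (hfst z hz u).symm rfl
      rw [h2]
      exact e.toOpenPartialHomeomorph.left_inv (e.mem_source.2 hz)
    exact eq_of_heq (TotalSpace.mk.inj h1).2
  · intro z hz f
    simp only [hz, dif_pos, IsLinearMap.mk'_apply]
    exact hg z hz f
  · have h := e.toOpenPartialHomeomorph.continuousOn
    rw [e.source_eq] at h
    refine (continuous_snd.comp_continuousOn h).congr ?_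
    intro p hp
    have hp' : p.proj ∈ e.baseSet := hp
    simp [hp']
  · have h := e.toOpenPartialHomeomorph.continuousOn_symm
    rw [e.target_eq] at h
    refine h.congr ?_
    rintro ⟨z, f⟩ hz
    have hz' : z ∈ e.baseSet := hz.1
    simp only [hz', dif_pos]
    exact hginv z hz' f

/-! ### Product bundle, direct sum, pullback -/

/-- The product bundle with fibre `V`. -/
def CBundle.product (Z : Type v) [TopologicalSpace Z] (V : Type u) [NormedAddCommGroup V]
    [NormedSpace ℂ V] [FiniteDimensional ℂ V] : CBundle.{u} Z :=
  letI : TopologicalSpace (TotalSpace Unit (fun _ : Z => V)) :=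
    TopologicalSpace.induced (fun p => ((p.proj, p.2) : Z × V)) inferInstance
  { Fiber := fun _ => V
    locallyTrivial := by
      intro z₀
      have hc : Continuous (fun p : TotalSpace Unit (fun _ : Z => V) => ((p.proj, p.2) : Z × V)) :=
        continuous_induced_dom
      refine exists_trivialization (continuous_fst.comp hc) isOpen_univ (fun _ => LinearMap.id)
        (fun _ f => f) (fun _ _ _ => rfl) (fun _ _ _ => rfl)
        (continuous_snd.comp hc).continuousOn ?_ z₀ trivial
      refine (continuous_induced_rng.2 ?_).continuousOn
      exact continuous_id }

/-- The direct sum of two bundles. The total space is the fibre product of the total spaces. -/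
def CBundle.directSum (E E' : CBundle.{u} Z) : CBundle.{u} Z :=
  letI : TopologicalSpace (TotalSpace Unit (fun z => E.Fiber z × E'.Fiber z)) :=
    TopologicalSpace.induced
      (fun p => ((⟨p.proj, p.2.1⟩, ⟨p.proj, p.2.2⟩) : E.Total × E'.Total)) inferInstance
  { Fiber := fun z => E.Fiber z × E'.Fiber z
    locallyTrivial := by
      intro z₀
      have hc : Continuous (fun p : TotalSpace Unit (fun z => E.Fiber z × E'.Fiber z) =>
        ((⟨p.proj, p.2.1⟩, ⟨p.proj, p.2.2⟩) : E.Total × E'.Total)) := continuous_induced_dom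
      obtain ⟨n, U, φ, ψ, hU, hz, hl, hr, hφ, hψ⟩ := E.exists_local z₀
      obtain ⟨n', U', φ', ψ', hU', hz', hl', hr', hφ', hψ'⟩ := E'.exists_local z₀
      have hp : Continuous (TotalSpace.proj :
          TotalSpace Unit (fun z => E.Fiber z × E'.Fiber z) → Z) :=
        E.continuous_proj.comp (continuous_fst.comp hc)
      refine exists_trivialization (F := (Fin n → ℂ) × (Fin n' → ℂ)) hp (hU.inter hU')
        (fun z => (φ z).prodMap (φ' z)) (fun z f => (ψ z f.1, ψ' z f.2)) ?_ ?_ ?_ ?_ z₀ ⟨hz, hz'⟩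
      · rintro z ⟨h, h'⟩ ⟨a, b⟩
        simp [hl z h, hl' z h']
      · rintro z ⟨h, h'⟩ ⟨a, b⟩
        simp [hr z h, hr' z h']
      · exact (hφ.comp (continuous_fst.comp hc).continuousOn (fun p hp => hp.1)).prodMk
          (hφ'.comp (continuous_snd.comp hc).continuousOn (fun p hp => hp.2))
      · rw [continuousOn_iff_continuous_domRestrict]
        refine continuous_induced_rng.2 ?_
        refine Continuous.prodMk ?_ ?_
        · exact continuousOn_iff_continuous_domRestrict.1
            (hψ.comp (f := fun q : Z × ((Fin n → ℂ) × (Fin n' → ℂ)) => (q.1, q.2.1))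
              (by fun_prop) (fun q hq => ⟨hq.1.1, trivial⟩))
        · exact continuousOn_iff_continuous_domRestrict.1
            (hψ'.comp (f := fun q : Z × ((Fin n → ℂ) × (Fin n' → ℂ)) => (q.1, q.2.2))
              (by fun_prop) (fun q hq => ⟨hq.1.2, trivial⟩)) }

/-- The pullback of a bundle along a continuous map. -/
def CBundle.pullback {Z' : Type v} [TopologicalSpace Z'] (f : C(Z', Z)) (E : CBundle.{u} Z) :
    CBundle.{u} Z' :=
  letI : TopologicalSpace (TotalSpace Unit (fun z => E.Fiber (f z))) :=
    TopologicalSpace.induced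
      (fun p => ((p.proj, ⟨f p.proj, p.2⟩) : Z' × E.Total)) inferInstance
  { Fiber := fun z => E.Fiber (f z)
    locallyTrivial := by
      intro z₀
      have hc : Continuous (fun p : TotalSpace Unit (fun z => E.Fiber (f z)) =>
        ((p.proj, ⟨f p.proj, p.2⟩) : Z' × E.Total)) := continuous_induced_dom
      obtain ⟨n, U, φ, ψ, hU, hz, hl, hr, hφ, hψ⟩ := E.exists_local (f z₀)
      refine exists_trivialization (continuous_fst.comp hc) (hU.preimage f.continuous)
        (fun z => φ (f z)) (fun z => ψ (f z)) (fun z h => hl _ h) (fun z h => hr _ h) ?_ ?_ z₀ hz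
      · exact hφ.comp (continuous_snd.comp hc).continuousOn (fun p hp => hp)
      · rw [continuousOn_iff_continuous_domRestrict]
        refine continuous_induced_rng.2 ?_
        refine Continuous.prodMk ?_ ?_
        · exact continuous_fst.comp continuous_subtype_val
        · exact continuousOn_iff_continuous_domRestrict.1
            (hψ.comp (f := fun q : Z' × (Fin n → ℂ) => (f q.1, q.2))
              (by fun_prop) (fun q hq => ⟨hq.1, trivial⟩)) }

/-- The direct sum of two morphisms. -/
def CBundle.Hom.directSum {E₀ E₁ E₀' E₁' : CBundle.{u} Z} (a : E₀.Hom E₁) (a' : E₀'.Hom E₁') :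
    (E₀.directSum E₀').Hom (E₁.directSum E₁') where
  map z := (a.map z).prodMap (a'.map z)
  continuous_map := by
    have hc : Continuous (fun p : (E₀.directSum E₀').Total =>
        ((⟨p.proj, p.2.1⟩, ⟨p.proj, p.2.2⟩) : E₀.Total × E₀'.Total)) := continuous_induced_dom
    exact continuous_induced_rng.2 ((a.continuous_map.comp (continuous_fst.comp hc)).prodMk
      (a'.continuous_map.comp (continuous_snd.comp hc)))

/-- The pullback of a morphism. -/
def CBundle.Hom.pullback {Z' : Type v} [TopologicalSpace Z'] (f : C(Z', Z))
    {E₀ E₁ : CBundle.{u} Z} (a : E₀.Hom E₁) : (E₀.pullback f).Hom (E₁.pullback f) where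
  map z := a.map (f z)
  continuous_map := by
    have hc : Continuous (fun p : (E₀.pullback f).Total =>
        ((p.proj, ⟨f p.proj, p.2⟩) : Z' × E₀.Total)) := continuous_induced_dom
    exact continuous_induced_rng.2 ((continuous_fst.comp hc).prodMk
      (a.continuous_map.comp (continuous_snd.comp hc)))

/-! ### Relative K-theory -/

/-- A triple `{E₀, E₁, a}` of two vector bundles and a morphism between them. -/
structure Triple (Z : Type v) [TopologicalSpace Z] where
  E₀ : CBundle.{u} Z
  E₁ : CBundle.{u} Z
  a : E₀.Hom E₁

namespace Triple

/-- The support: the set of points at which the morphism is not an isomorphism. -/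
def supp (ξ : Triple.{u} Z) : Set Z := {z | ¬ Function.Bijective (ξ.a.map z)}

/-- A triple is trivial if its support is empty. -/
def IsTrivial (ξ : Triple.{u} Z) : Prop := ξ.supp = ∅

/-- Isomorphism of triples. -/
def Isomorphic (ξ η : Triple.{u} Z) : Prop :=
  ∃ (φ₀ : ξ.E₀.Iso η.E₀) (φ₁ : ξ.E₁.Iso η.E₁),
    ∀ z u, η.a.map z (φ₀.equiv z u) = φ₁.equiv z (ξ.a.map z u)

/-- The direct sum of two triples. -/
def directSum (ξ η : Triple.{u} Z) : Triple.{u} Z :=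
  ⟨ξ.E₀.directSum η.E₀, ξ.E₁.directSum η.E₁, ξ.a.directSum η.a⟩

/-- The pullback of a triple along a continuous map. -/
def pullback {Z' : Type v} [TopologicalSpace Z'] (f : C(Z', Z)) (ξ : Triple.{u} Z) :
    Triple.{u} Z' :=
  ⟨ξ.E₀.pullback f, ξ.E₁.pullback f, ξ.a.pullback f⟩

/-- The triples whose support is a compact subset of the complement of `Y`. -/
def IsAdmissible (Y : Set Z) (ξ : Triple.{u} Z) : Prop :=
  IsCompact ξ.supp ∧ ξ.supp ⊆ Yᶜ

/-- The inclusion of `Z` into `Z × [0,1]` as `Z × {t}`. -/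
def slice (Z : Type v) [TopologicalSpace Z] (t : unitInterval) : C(Z, Z × unitInterval) :=
  ⟨fun z => (z, t), by fun_prop⟩

/-- Homotopy of triples, through admissible triples on `(Z × [0,1], Y × [0,1])`. -/
def Homotopic (Y : Set Z) (ξ η : Triple.{u} Z) : Prop :=
  ∃ h : Triple.{u} (Z × unitInterval), IsAdmissible (Y ×ˢ Set.univ) h ∧
    Isomorphic (h.pullback (slice Z 0)) ξ ∧ Isomorphic (h.pullback (slice Z 1)) η

end Triple

/-- The set `L(Z, Y)` of admissible triples. -/
def L (Z : Type v) [TopologicalSpace Z] (Y : Set Z) : Type (max (u + 1) v) :=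
  {ξ : Triple.{u} Z // ξ.IsAdmissible Y}

/-- Stable homotopy of admissible triples: `ξ ⊕ η₀ ≃ ξ' ⊕ η₁` with trivial `η₀`, `η₁`. -/
def StablyHomotopic (Y : Set Z) (ξ ξ' : L.{u} Z Y) : Prop :=
  ∃ η₀ η₁ : Triple.{u} Z, η₀.IsTrivial ∧ η₁.IsTrivial ∧
    Triple.Homotopic Y (ξ.1.directSum η₀) (ξ'.1.directSum η₁)

end

/-- The relative K-theory `K(Z, Y)`: the set of classes of admissible triples under (the
equivalence relation generated by) stable homotopy. -/
def K (Z : Type v) [TopologicalSpace Z] (Y : Set Z) : Type (max (u + 1) v) :=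
  Quot (StablyHomotopic.{u} (Z := Z) Y)

/-- The class `[E₀, E₁, a]` of an admissible triple. -/
def K.mk {Z : Type v} [TopologicalSpace Z] {Y : Set Z} (ξ : L.{u} Z Y) : K.{u} Z Y :=
  Quot.mk _ ξ

/-- The odd K-theory `K⁻¹(X, Y) = K(X × ℝ, Y × ℝ)`. -/
abbrev KOdd (X : Type v) [TopologicalSpace X] (Y : Set X) : Type (max (u + 1) v) :=
  K.{u} (X × ℝ) (Y ×ˢ Set.univ)

/-! ### The index bundle of a Fredholm morphism between product bundles -/

section Fredholm

variable {Z : Type v} [TopologicalSpace Z]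
variable {W F : Type u} [NormedAddCommGroup W] [NormedSpace ℂ W]
  [NormedAddCommGroup F] [NormedSpace ℂ F]

/-- A norm continuous family of Fredholm operators of index zero, invertible outside a compact
set and on `Y`. -/
structure IsFredholmMorphism (Y : Set Z) (T : Z → W →L[ℂ] F) : Prop where
  continuous : Continuous T
  fredholm : ∀ z, (T z).IsFredholm
  index_zero : ∀ z, (T z).toLinearMap.index = 0
  invertible_off_compact : ∃ C : Set Z, IsCompact C ∧ ∀ z, z ∉ C → (T z).IsInvertible
  invertible_on : ∀ z ∈ Y, (T z).IsInvertible

/-- Transversality of a subspace `V` to the images of the family `T`. -/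
def IsTransversal (T : Z → W →L[ℂ] F) (V : Submodule ℂ F) : Prop :=
  ∀ z, LinearMap.range (T z).toLinearMap ⊔ V = ⊤

/-- The fibre `{u | T u ∈ V}` is finite dimensional. -/
theorem finiteDimensional_comap {T : W →L[ℂ] F} (hT : T.IsFredholm) (V : Submodule ℂ F)
    [FiniteDimensional ℂ V] : FiniteDimensional ℂ (V.comap T.toLinearMap) := by
  have := hT.finite_ker
  rw [← Submodule.fg_iff_finiteDimensional]
  refine Submodule.fg_of_fg_map_of_fg_inf_ker T.toLinearMap ?_ ?_
  · rw [Submodule.fg_iff_finiteDimensional]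
    exact Submodule.finiteDimensional_of_le (S₂ := V) (Submodule.map_comap_le _ _)
  · rw [Submodule.fg_iff_finiteDimensional]
    exact Submodule.finiteDimensional_of_le (S₂ := LinearMap.ker T.toLinearMap) inf_le_right

/-- The auxiliary operator `(u, v) ↦ (T u - v, P u)`. -/
noncomputable def auxOp (V : Submodule ℂ F) {N : Submodule ℂ W} (P : W →L[ℂ] N) (T : W →L[ℂ] F) :
    W × V →L[ℂ] F × N :=
  ((T.comp (ContinuousLinearMap.fst ℂ W V)) -
    V.subtypeL.comp (ContinuousLinearMap.snd ℂ W V)).prod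
    (P.comp (ContinuousLinearMap.fst ℂ W V))

@[simp] theorem auxOp_apply (V : Submodule ℂ F) {N : Submodule ℂ W} (P : W →L[ℂ] N)
    (T : W →L[ℂ] F) (p : W × V) : auxOp V P T p = (T p.1 - p.2, P p.1) := rfl

variable [CompleteSpace W] [CompleteSpace F]

/-- If `V` is transversal to the image of `T z₀`, the auxiliary operators are invertible near
`z₀`. -/
theorem exists_auxOp {T : Z → W →L[ℂ] F} (hc : Continuous T) (z₀ : Z) (hT : (T z₀).IsFredholm)
    (V : Submodule ℂ F) [FiniteDimensional ℂ V]
    (hV : LinearMap.range (T z₀).toLinearMap ⊔ V = ⊤) :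
    ∃ (P : W →L[ℂ] V.comap (T z₀).toLinearMap) (U : Set Z), IsOpen U ∧ z₀ ∈ U ∧
      Continuous (fun z => auxOp V P (T z)) ∧ ∀ z ∈ U, (auxOp V P (T z)).IsInvertible := by
  have := finiteDimensional_comap hT V
  obtain ⟨P, hP⟩ := Submodule.ClosedComplemented.of_finiteDimensional
    (V.comap (T z₀).toLinearMap)
  have hcont : Continuous (fun z => auxOp V P (T z)) := by
    have h1 : Continuous (fun z => (T z).comp (ContinuousLinearMap.fst ℂ W V) -
        V.subtypeL.comp (ContinuousLinearMap.snd ℂ W V)) :=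
      (hc.clm_comp continuous_const).sub continuous_const
    exact (ContinuousLinearMap.prodₗᵢ ℂ).continuous.comp (h1.prodMk
      (continuous_const (y := P.comp (ContinuousLinearMap.fst ℂ W V))))
  refine ⟨P, {z | (auxOp V P (T z)).IsInvertible}, ?_, ?_, hcont, fun z hz => hz⟩
  · exact (ContinuousLinearEquiv.isOpen (𝕜 := ℂ) (E := W × V)
      (F := F × V.comap (T z₀).toLinearMap)).preimage hcont
  · have hb : Function.Bijective (auxOp V P (T z₀)) := by
      constructor
      · rw [injective_iff_map_eq_zero]
        rintro ⟨u, v⟩ h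
        simp only [auxOp_apply, Prod.mk_eq_zero] at h
        obtain ⟨h1, h2⟩ := h
        have hu : u ∈ V.comap (T z₀).toLinearMap := by
          simp only [Submodule.mem_comap]
          have : (T z₀) u = v := sub_eq_zero.1 h1
          rw [ContinuousLinearMap.coe_coe, this]
          exact v.2
        have h3 := hP ⟨u, hu⟩
        simp only [h2] at h3
        have hu0 : u = 0 := by simpa using (congrArg Subtype.val h3).symm
        subst hu0
        have : v = 0 := by
          ext
          simpa using h1
        simp [this]
      · rintro ⟨f, k⟩
        have hf : f ∈ LinearMap.range (T z₀).toLinearMap ⊔ V := hV ▸ Submodule.mem_top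
        obtain ⟨_, ⟨u, rfl⟩, v, hv, rfl⟩ := Submodule.mem_sup.1 hf
        let e : V.comap (T z₀).toLinearMap := k - P u
        have he : (T z₀) (e : W) ∈ V := e.2
        refine ⟨(u + e, ⟨(T z₀) (e : W), he⟩ - ⟨v, hv⟩), ?_⟩
        simp only [auxOp_apply, map_add, Prod.mk.injEq]
        constructor
        · simp only [Submodule.coe_sub, ContinuousLinearMap.coe_coe]
          abel
        · rw [hP e]
          simp [e]
    exact ⟨ContinuousLinearEquiv.ofBijective _ (LinearMap.ker_eq_bot.2 hb.1)
      (LinearMap.range_eq_top.2 hb.2), by ext <;> rfl⟩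

/-- Existence of a finite dimensional transversal subspace. -/
theorem exists_transversal {Y : Set Z} {T : Z → W →L[ℂ] F} (hT : IsFredholmMorphism Y T) :
    ∃ V : Submodule ℂ F, FiniteDimensional ℂ V ∧ IsTransversal T V := by
  obtain ⟨C, hC, hinv⟩ := hT.invertible_off_compact
  have key : ∃ V : Submodule ℂ F, FiniteDimensional ℂ V ∧
      ∀ z ∈ C, LinearMap.range (T z).toLinearMap ⊔ V = ⊤ := by
    refine hC.induction_on (p := fun s => ∃ V : Submodule ℂ F, FiniteDimensional ℂ V ∧
      ∀ z ∈ s, LinearMap.range (T z).toLinearMap ⊔ V = ⊤) ?_ ?_ ?_ ?_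
    · exact ⟨⊥, inferInstance, by simp⟩
    · rintro s t hst ⟨V, hV, h⟩
      exact ⟨V, hV, fun z hz => h z (hst hz)⟩
    · rintro s t ⟨V, hV, h⟩ ⟨V', hV', h'⟩
      refine ⟨V ⊔ V', inferInstance, ?_⟩
      rintro z (hz | hz)
      · rw [← sup_assoc, h z hz, top_sup_eq]
      · rw [sup_comm V, ← sup_assoc, h' z hz, top_sup_eq]
    · intro z _
      obtain ⟨V, hV⟩ := (LinearMap.range (T z).toLinearMap).exists_isCompl
      have hfin : FiniteDimensional ℂ V :=
        Submodule.fg_iff_finiteDimensional _ |>.1 (Submodule.CoFG.fg_of_isCompl hV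
          (hT.fredholm z).finite_coker)
      obtain ⟨P, U, hU, hz, -, hinv⟩ :=
        exists_auxOp hT.continuous z (hT.fredholm z) V hV.sup_eq_top
      refine ⟨U, mem_nhdsWithin_of_mem_nhds (hU.mem_nhds hz), V, hfin, ?_⟩
      intro y hy
      rw [eq_top_iff]
      intro f _
      obtain ⟨⟨u, v⟩, huv⟩ := (hinv y hy).surjective (f, 0)
      simp only [auxOp_apply, Prod.mk.injEq] at huv
      exact Submodule.mem_sup.2 ⟨T y u, ⟨u, rfl⟩, -v, V.neg_mem v.2, by
        rw [← sub_eq_add_neg]; exact huv.1⟩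
  obtain ⟨V, hV, h⟩ := key
  refine ⟨V, hV, fun z => ?_⟩
  by_cases hz : z ∈ C
  · exact h z hz
  · rw [LinearMap.range_eq_top.2 (hinv z hz).surjective, top_sup_eq]

/-- The bundle `E(T, V)` with fibres `{u ∈ W | T_z u ∈ V}`, topologised as a subspace of
`Z × W`. -/
def kernelBundle {Y : Set Z} {T : Z → W →L[ℂ] F} (hT : IsFredholmMorphism Y T)
    (V : Submodule ℂ F) [FiniteDimensional ℂ V] (hV : IsTransversal T V) : CBundle.{u} Z :=
  letI : TopologicalSpace (TotalSpace Unit (fun z => V.comap (T z).toLinearMap)) :=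
    TopologicalSpace.induced (fun p => ((p.proj, (p.2 : W)) : Z × W)) inferInstance
  { Fiber := fun z => V.comap (T z).toLinearMap
    locallyTrivial := by
      intro z₀
      have hc : Continuous (fun p : TotalSpace Unit (fun z => V.comap (T z).toLinearMap) =>
        ((p.proj, (p.2 : W)) : Z × W)) := continuous_induced_dom
      have := finiteDimensional_comap (hT.fredholm z₀) V
      obtain ⟨P, U, hU, hz, hcont, hinv⟩ :=
        exists_auxOp hT.continuous z₀ (hT.fredholm z₀) V (hV z₀)
      classical
      have hmem : ∀ z ∈ U, ∀ f, ((auxOp V P (T z)).inverse (0, f)).1 ∈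
          V.comap (T z).toLinearMap := by
        intro z hz f
        have h := (hinv z hz).self_apply_inverse (0, f)
        simp only [auxOp_apply, Prod.mk.injEq] at h
        rw [Submodule.mem_comap, ContinuousLinearMap.coe_coe, sub_eq_zero.1 h.1]
        exact Subtype.property _
      refine exists_trivialization (continuous_fst.comp hc) hU
        (fun z => P.toLinearMap.comp (Submodule.subtype _))
        (fun z f => if hz : z ∈ U then ⟨((auxOp V P (T z)).inverse (0, f)).1, hmem z hz f⟩ else 0)
        ?_ ?_ ?_ ?_ z₀ hz
      · rintro z hz ⟨u, hu⟩
        simp only [hz, dif_pos]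
        ext
        have h := (hinv z hz).inverse_apply_self (u, ⟨T z u, hu⟩)
        simp only [auxOp_apply, sub_self] at h
        change ((auxOp V P (T z)).inverse (0, P u)).1 = u
        rw [h]
      · intro z hz f
        simp only [hz, dif_pos]
        have h := (hinv z hz).self_apply_inverse (0, f)
        simp only [auxOp_apply, Prod.mk.injEq] at h
        exact h.2
      · exact (P.continuous.comp (continuous_snd.comp hc)).continuousOn
      · rw [continuousOn_iff_continuous_domRestrict]
        refine continuous_induced_rng.2 ?_
        refine Continuous.prodMk (continuous_fst.comp continuous_subtype_val) ?_
        have hI : ContinuousOn (fun z => (auxOp V P (T z)).inverse) U := by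
          intro z hz
          refine ContinuousAt.continuousWithinAt ?_
          exact ((hinv z hz).contDiffAt_map_inverse (n := 0)).continuousAt.comp
            (f := fun z => auxOp V P (T z)) hcont.continuousAt
        have hI' : ContinuousOn (fun q : Z × V.comap (T z₀).toLinearMap =>
            ((auxOp V P (T q.1)).inverse (0, q.2)).1) (U ×ˢ Set.univ) := by
          refine continuous_fst.comp_continuousOn ?_
          refine ContinuousOn.clm_apply ?_ (by fun_prop)
          exact hI.comp continuous_fst.continuousOn (fun q hq => hq.1)
        refine (continuousOn_iff_continuous_domRestrict.1 hI').congr ?_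
        rintro ⟨⟨z, f⟩, hz⟩
        have hz' : z ∈ U := hz.1
        simp [hz'] }

/-- The triple `{E(T, V), Θ(V), T|E(T, V)}`. -/
noncomputable def indexTriple {Y : Set Z} {T : Z → W →L[ℂ] F} (hT : IsFredholmMorphism Y T)
    (V : Submodule ℂ F) [FiniteDimensional ℂ V] (hV : IsTransversal T V) : Triple.{u} Z where
  E₀ := kernelBundle hT V hV
  E₁ := CBundle.product Z V
  a :=
    { map := fun z => (T z).toLinearMap.restrict (p := V.comap (T z).toLinearMap) (q := V)
        (fun _ hu => hu)
      continuous_map := by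
        have hc : Continuous (fun p : (kernelBundle hT V hV).Total =>
          ((p.proj, p.2.1) : Z × W)) := continuous_induced_dom
        refine continuous_induced_rng.2 ?_
        refine Continuous.prodMk (continuous_fst.comp hc) ?_
        refine Continuous.subtype_mk ?_ _
        exact (hT.continuous.comp (continuous_fst.comp hc)).clm_apply (continuous_snd.comp hc) }

/-- The support of the index triple is the set of points where `T` is not invertible. -/
theorem supp_indexTriple {Y : Set Z} {T : Z → W →L[ℂ] F} (hT : IsFredholmMorphism Y T)
    (V : Submodule ℂ F) [FiniteDimensional ℂ V] (hV : IsTransversal T V) :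
    (indexTriple hT V hV).supp = {z | ¬ (T z).IsInvertible} := by
  ext z
  refine not_congr ⟨fun h => ?_, fun h => ?_⟩
  · have hb : Function.Bijective (T z) := by
      constructor
      · rw [injective_iff_map_eq_zero]
        intro u hu
        have hm : u ∈ V.comap (T z).toLinearMap := by
          simp [hu]
        have h0 : (⟨u, hm⟩ : V.comap (T z).toLinearMap) = 0 := h.1 (by
          exact (Subtype.ext hu : (⟨T z u, hm⟩ : V) = 0).trans (map_zero _).symm)
        exact congrArg Subtype.val h0
      · intro f
        have hf : f ∈ LinearMap.range (T z).toLinearMap ⊔ V := hV z ▸ Submodule.mem_top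
        obtain ⟨_, ⟨u, rfl⟩, v, hv, rfl⟩ := Submodule.mem_sup.1 hf
        obtain ⟨w, hw⟩ := h.2 ⟨v, hv⟩
        have hw' : (T z) w.1 = v := congrArg Subtype.val hw
        exact ⟨u + w.1, by simp [hw']⟩
    exact ⟨ContinuousLinearEquiv.ofBijective _ (LinearMap.ker_eq_bot.2 hb.1)
      (LinearMap.range_eq_top.2 hb.2), by ext; rfl⟩
  · constructor
    · rintro ⟨u, hu⟩ ⟨w, hw⟩ huw
      exact Subtype.ext (h.injective (congrArg Subtype.val huw))
    · rintro ⟨v, hv⟩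
      obtain ⟨u, hu⟩ := h.surjective v
      exact ⟨⟨u, by simpa [hu] using hv⟩, Subtype.ext hu⟩

theorem indexTriple_isAdmissible {Y : Set Z} {T : Z → W →L[ℂ] F} (hT : IsFredholmMorphism Y T)
    (V : Submodule ℂ F) [FiniteDimensional ℂ V] (hV : IsTransversal T V) :
    (indexTriple hT V hV).IsAdmissible Y := by
  rw [Triple.IsAdmissible, supp_indexTriple]
  obtain ⟨C, hC, hinv⟩ := hT.invertible_off_compact
  constructor
  · refine hC.of_isClosed_subset ?_ (fun z hz => by_contra fun h => hz (hinv z h))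
    exact ((ContinuousLinearEquiv.isOpen (𝕜 := ℂ) (E := W) (F := F)).preimage
      hT.continuous).isClosed_compl
  · exact fun z hz hY => hz (hT.invertible_on z hY)

/-- The class `[E(T, V), Θ(V), T|E(T, V)]` in `K(Z, Y)`. -/
noncomputable def indexClass {Y : Set Z} {T : Z → W →L[ℂ] F} (hT : IsFredholmMorphism Y T)
    (V : Submodule ℂ F) [FiniteDimensional ℂ V] (hV : IsTransversal T V) : K.{u} Z Y :=
  K.mk ⟨indexTriple hT V hV, indexTriple_isAdmissible hT V hV⟩

/-- The index bundle `ind(T) ∈ K(Z, Y)`, formed with some finite dimensional transversal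
subspace. -/
noncomputable def ind {Y : Set Z} {T : Z → W →L[ℂ] F} (hT : IsFredholmMorphism Y T) :
    K.{u} Z Y :=
  haveI := (exists_transversal hT).choose_spec.1
  indexClass hT (exists_transversal hT).choose (exists_transversal hT).choose_spec.2

end Fredholm

/-! ### Selfadjoint Fredholm families and their index bundle -/

section Selfadjoint

variable {X : Type v} [TopologicalSpace X]
variable {W H : Type u} [NormedAddCommGroup W] [InnerProductSpace ℂ W]
  [NormedAddCommGroup H] [InnerProductSpace ℂ H]

/-- For an injection `k : W → H`, a bounded operator `A : W → H` regarded as an (in general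
unbounded) operator in `H` with domain `k(W)`. -/
noncomputable def toUnbounded (k : W →L[ℂ] H) (hk : Function.Injective k) (A : W →L[ℂ] H) :
    H →ₗ.[ℂ] H where
  domain := LinearMap.range k.toLinearMap
  toFun := A.toLinearMap.comp (LinearEquiv.ofInjective k.toLinearMap hk).symm.toLinearMap

theorem mem_graph_toUnbounded {k : W →L[ℂ] H} {hk : Function.Injective k} {A : W →L[ℂ] H}
    {x y : H} : (x, y) ∈ (toUnbounded k hk A).graph ↔ ∃ w, k w = x ∧ A w = y := by
  rw [LinearPMap.mem_graph_iff]
  constructor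
  · rintro ⟨⟨_, ⟨w, rfl⟩⟩, h1, h2⟩
    refine ⟨w, h1, ?_⟩
    refine Eq.trans ?_ h2
    have : (LinearEquiv.ofInjective k.toLinearMap hk).symm ⟨k.toLinearMap w, ⟨w, rfl⟩⟩ = w :=
      (LinearEquiv.symm_apply_eq _).2 rfl
    exact congrArg A this.symm
  · rintro ⟨w, rfl, rfl⟩
    refine ⟨⟨k w, ⟨w, rfl⟩⟩, rfl, ?_⟩
    have : (LinearEquiv.ofInjective k.toLinearMap hk).symm ⟨k.toLinearMap w, ⟨w, rfl⟩⟩ = w :=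
      (LinearEquiv.symm_apply_eq _).2 rfl
    change A ((LinearEquiv.ofInjective k.toLinearMap hk).symm _) = A w
    exact congrArg A this

variable [CompleteSpace H]

/-- A norm continuous family `D` of Fredholm operators in `L(W, H)` which are selfadjoint as
operators in `H` with the dense domain `k(W)`, and which are invertible on `Y`. -/
structure IsSelfadjointFredholmFamily (k : W →L[ℂ] H) (Y : Set X) (D : X → W →L[ℂ] H) : Prop where
  injective : Function.Injective k
  denseRange : DenseRange k
  continuous : Continuous D
  selfadjoint : ∀ x, IsSelfAdjoint (toUnbounded k injective (D x))
  fredholm : ∀ x, (D x).IsFredholm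
  invertible_on : ∀ x ∈ Y, (D x).IsInvertible

/-- The suspension `(x, s) ↦ D x + i s`. -/
noncomputable def suspension (k : W →L[ℂ] H) (D : X → W →L[ℂ] H) (z : X × ℝ) : W →L[ℂ] H :=
  D z.1 + (Complex.I * (z.2 : ℂ)) • k

theorem graph_of_selfadjoint {k : W →L[ℂ] H} {hk : Function.Injective k} {A : W →L[ℂ] H}
    (hA : IsSelfAdjoint (toUnbounded k hk A)) (x y : H) :
    (∃ w, k w = x ∧ A w = y) ↔ ∀ w, inner ℂ y (k w) = inner ℂ x (A w) := by
  have hd : Dense ((toUnbounded k hk A).domain : Set H) := hA.dense_domain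
  have h1 := LinearPMap.adjoint_graph_eq_graph_adjoint hd
  rw [LinearPMap.isSelfAdjoint_def.1 hA] at h1
  rw [← mem_graph_toUnbounded (hk := hk), h1, Submodule.mem_adjoint_iff]
  constructor
  · intro h w
    have h2 := h (k w) (A w) (mem_graph_toUnbounded.2 ⟨w, rfl, rfl⟩)
    rw [← inner_conj_symm, ← inner_conj_symm x]
    exact congrArg _ (sub_eq_zero.1 h2).symm
  · intro h a b hab
    obtain ⟨w, rfl, rfl⟩ := mem_graph_toUnbounded.1 hab
    rw [← inner_conj_symm, ← inner_conj_symm (k w), h w, sub_self]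

theorem symm_of_selfadjoint {k : W →L[ℂ] H} {hk : Function.Injective k} {A : W →L[ℂ] H}
    (hA : IsSelfAdjoint (toUnbounded k hk A)) (u w : W) :
    inner ℂ (A u) (k w) = inner ℂ (k u) (A w) :=
  (graph_of_selfadjoint hA (k u) (A u)).1 ⟨u, rfl, rfl⟩ w

theorem norm_sq_of_selfadjoint {k : W →L[ℂ] H} {hk : Function.Injective k} {A : W →L[ℂ] H}
    (hA : IsSelfAdjoint (toUnbounded k hk A)) (s : ℝ) (u : W) :
    ‖A u + (Complex.I * (s : ℂ)) • k u‖ ^ 2 = ‖A u‖ ^ 2 + s ^ 2 * ‖k u‖ ^ 2 := by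
  have him : (inner ℂ (A u) (k u)).im = 0 := by
    have h := symm_of_selfadjoint hA u u
    rw [← inner_conj_symm (k u)] at h
    exact Complex.conj_eq_iff_im.1 h.symm
  rw [norm_add_sq (𝕜 := ℂ), inner_smul_right, norm_smul]
  simp [him, mul_pow]

theorem invertible_of_selfadjoint [CompleteSpace W] {k : W →L[ℂ] H} {hk : Function.Injective k} {A : W →L[ℂ] H}
    (hA : IsSelfAdjoint (toUnbounded k hk A)) {s : ℝ} (hs : s ≠ 0) :
    (A + (Complex.I * (s : ℂ)) • k).IsInvertible := by
  have hs2 : 0 < s ^ 2 := by positivity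
  have hnorm := norm_sq_of_selfadjoint hA
  have hzero : ∀ t : ℝ, t ≠ 0 → ∀ u, A u + (Complex.I * (t : ℂ)) • k u = 0 → u = 0 := by
    intro t ht u hu
    have h := hnorm t u
    rw [hu, norm_zero] at h
    have ht2 : 0 < t ^ 2 := by positivity
    have h2 : ‖k u‖ ^ 2 = 0 := by nlinarith [sq_nonneg ‖A u‖, sq_nonneg ‖k u‖]
    have h3 : k u = 0 := by simpa using h2
    exact hk (h3.trans (map_zero k).symm)
  have hcl : IsClosed (Set.range (k.prod A)) := by
    have : Set.range (k.prod A) =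
        {p : H × H | ∀ w, inner ℂ p.2 (k w) = inner ℂ p.1 (A w)} := by
      ext ⟨x, y⟩
      rw [Set.mem_ofPred_eq, ← graph_of_selfadjoint hA x y]
      simp
    rw [this, Set.ofPred_forall]
    exact isClosed_iInter fun w => isClosed_eq (by fun_prop) (by fun_prop)
  have hinj : Function.Injective (k.prod A) := fun a b h => hk (congrArg Prod.fst h)
  obtain ⟨c, hc⟩ := (k.prod A).antilipschitz_of_injective_of_isClosed_range hinj hcl
  let S : W →L[ℂ] H := A + (Complex.I * (s : ℂ)) • k
  have hSn : ∀ u, ‖S u‖ ^ 2 = ‖A u‖ ^ 2 + s ^ 2 * ‖k u‖ ^ 2 := hnorm s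
  have hS : AntilipschitzWith (c * (1 + ‖s‖₊⁻¹)) S := by
    refine AddMonoidHomClass.antilipschitz_of_bound S fun u => ?_
    have h1 : ‖u‖ ≤ c * ‖(k.prod A) u‖ :=
      ZeroHomClass.bound_of_antilipschitz (k.prod A) hc u
    have hs' : 0 < |s| := abs_pos.2 hs
    have h2 : ‖A u‖ ≤ ‖S u‖ := by
      refine abs_le_of_sq_le_sq' ?_ (norm_nonneg _) |>.2
      nlinarith [hSn u, mul_nonneg hs2.le (sq_nonneg ‖k u‖)]
    have h3 : |s| * ‖k u‖ ≤ ‖S u‖ := by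
      refine abs_le_of_sq_le_sq' ?_ (norm_nonneg _) |>.2
      rw [mul_pow, sq_abs]
      nlinarith [hSn u, sq_nonneg ‖A u‖]
    have h4 : ‖k u‖ ≤ |s|⁻¹ * ‖S u‖ := by
      rw [inv_mul_eq_div, le_div_iff₀ hs']
      linarith
    have h5 : ‖(k.prod A) u‖ ≤ (1 + |s|⁻¹) * ‖S u‖ := by
      have h6 : 0 ≤ |s|⁻¹ * ‖S u‖ := by positivity
      have h7 := norm_nonneg (S u)
      refine max_le ?_ ?_
      · change ‖k u‖ ≤ _
        linarith
      · change ‖A u‖ ≤ _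
        linarith
    have h8 : (c : ℝ) * ‖(k.prod A) u‖ ≤ c * ((1 + |s|⁻¹) * ‖S u‖) :=
      mul_le_mul_of_nonneg_left h5 c.2
    push_cast
    rw [mul_assoc, Real.norm_eq_abs]
    exact h1.trans h8
  have hSc : IsClosed (Set.range S) := hS.isClosed_range S.uniformContinuous
  have hSd : LinearMap.range S.toLinearMap = ⊤ := by
    have : CompleteSpace (LinearMap.range S.toLinearMap) :=
      IsClosed.completeSpace_coe (s := (LinearMap.range S.toLinearMap : Set H)) (hs := hSc)
    rw [← Submodule.orthogonal_eq_bot_iff, eq_bot_iff]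
    intro y hy
    rw [Submodule.mem_orthogonal'] at hy
    have hy' : ∀ w, inner ℂ ((Complex.I * (s : ℂ)) • y) (k w) = inner ℂ y (A w) := by
      intro w
      have h := hy (S w) ⟨w, rfl⟩
      change inner ℂ y (A w + (Complex.I * (s : ℂ)) • k w) = 0 at h
      rw [inner_add_right, inner_smul_right] at h
      rw [inner_smul_left]
      simp only [map_mul, Complex.conj_I, Complex.conj_ofReal]
      linear_combination -h
    obtain ⟨w, hw1, hw2⟩ := (graph_of_selfadjoint hA y _).2 hy'
    have h0 := hzero (-s) (neg_ne_zero.2 hs) w (by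
      rw [hw1, hw2, ← add_smul]
      simp)
    rw [Submodule.mem_bot, ← hw1, h0, map_zero]
  exact ⟨ContinuousLinearEquiv.ofBijective S
    (LinearMap.ker_eq_bot.2 hS.injective) hSd, by ext; rfl⟩

theorem index_eq_zero_of_selfadjoint {k : W →L[ℂ] H} {hk : Function.Injective k} {A : W →L[ℂ] H}
    (hA : IsSelfAdjoint (toUnbounded k hk A)) (hF : A.IsFredholm) :
    A.toLinearMap.index = 0 := by
  have hcl : IsClosed (LinearMap.range A.toLinearMap : Set H) := hF.isClosed_range
  have : CompleteSpace (LinearMap.range A.toLinearMap) :=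
    IsClosed.completeSpace_coe (s := (LinearMap.range A.toLinearMap : Set H)) (hs := hcl)
  have h1 : (LinearMap.range A.toLinearMap)ᗮ =
      (LinearMap.ker A.toLinearMap).map k.toLinearMap := by
    ext y
    rw [Submodule.mem_orthogonal', Submodule.mem_map]
    have h2 := graph_of_selfadjoint hA y 0
    constructor
    · intro h
      obtain ⟨w, hw1, hw2⟩ := h2.2 (fun w => by
        rw [inner_zero_left, h (A w) ⟨w, rfl⟩])
      exact ⟨w, hw2, hw1⟩
    · rintro ⟨w, hw1, hw2⟩ _ ⟨u, rfl⟩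
      have h3 := h2.1 ⟨w, hw2, hw1⟩ u
      rw [inner_zero_left] at h3
      exact h3.symm
  rw [LinearMap.index_eq_finrank_sub, sub_eq_zero, Nat.cast_inj,
    (Submodule.quotientEquivOfIsCompl _ _
      (Submodule.isCompl_orthogonal (LinearMap.range A.toLinearMap))).finrank_eq, h1]
  exact (Submodule.equivMapOfInjective k.toLinearMap hk _).finrank_eq

variable [CompleteSpace W]

/-- The suspension of a selfadjoint Fredholm family over a compact space is a Fredholm morphism
over `X × ℝ`. -/
theorem suspension_isFredholmMorphism [CompactSpace X] {k : W →L[ℂ] H} {Y : Set X}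
    {D : X → W →L[ℂ] H} (hD : IsSelfadjointFredholmFamily k Y D) :
    IsFredholmMorphism (Y ×ˢ Set.univ) (suspension k D) := by
  have h0 : ∀ x, suspension k D (x, 0) = D x := fun x => by simp [suspension]
  have hs : ∀ x (s : ℝ), s ≠ 0 → (suspension k D (x, s)).IsInvertible := fun x s h =>
    invertible_of_selfadjoint (hD.selfadjoint x) h
  refine ⟨?_, ?_, ?_, ?_, ?_⟩
  · unfold suspension
    have := hD.continuous
    fun_prop
  · rintro ⟨x, s⟩
    rcases eq_or_ne s 0 with rfl | h
    · rw [h0]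
      exact hD.fredholm x
    · obtain ⟨e, he⟩ := hs x s h
      rw [← he]
      exact ContinuousLinearMap.IsFredholm.of_isQuasiInverse
        (v := (e.symm : H →L[ℂ] W)) e.toLinearEquiv.isQuasiInverse
  · rintro ⟨x, s⟩
    rcases eq_or_ne s 0 with rfl | h
    · rw [h0]
      exact index_eq_zero_of_selfadjoint (hD.selfadjoint x) (hD.fredholm x)
    · obtain ⟨e, he⟩ := hs x s h
      rw [← he]
      exact LinearEquiv.index_eq_zero (e := e.toLinearEquiv)
  · refine ⟨Set.univ ×ˢ {0}, isCompact_univ.prod isCompact_singleton, ?_⟩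
    rintro ⟨x, s⟩ hx
    exact hs x s (by simpa using hx)
  · rintro ⟨x, s⟩ ⟨hx, -⟩
    rcases eq_or_ne s 0 with rfl | h
    · rw [h0]
      exact hD.invertible_on x hx
    · exact hs x s h

/-- The index bundle of a selfadjoint Fredholm family, `ind(D) ∈ K⁻¹(X, Y)`, defined as the index
bundle of its suspension. -/
noncomputable def sind [CompactSpace X] {k : W →L[ℂ] H} {Y : Set X} {D : X → W →L[ℂ] H}
    (hD : IsSelfadjointFredholmFamily k Y D) : KOdd.{u} X Y :=
  ind (suspension_isFredholmMorphism hD)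

end Selfadjoint

/-! ### The Riesz map -/

section Riesz

variable {E H : Type u} [NormedAddCommGroup E] [InnerProductSpace ℂ E] [CompleteSpace E]
  [NormedAddCommGroup H] [InnerProductSpace ℂ H] [CompleteSpace H]

/-- The operator `H → E` representing the scalar product of `H` in `E`, for `j : E → H`. -/
noncomputable def rieszMap (j : E →L[ℂ] H) : H →L[ℂ] E := ContinuousLinearMap.adjoint j

theorem inner_rieszMap (j : E →L[ℂ] H) (u : H) (v : E) :
    inner ℂ (rieszMap j u) v = inner ℂ u (j v) :=
  ContinuousLinearMap.adjoint_inner_left j v u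

end Riesz

end IndexBundle

/-!
Stabilising `T` by the map `V ⊕ V' → F`, `(v, v') ↦ (1 - t) v + t v'`, turns `E(T, V)` at `t = 0`
and `E(T, V')` at `t = 1`, up to trivial summands, into the ends of one bundle. So the index class
is independent of `V` and invariant under homotopies of Fredholm morphisms.

By the form identity, `i` and `K` intertwine `D + is` with `B + isK₀`. As both families have
index `0`, the fibres over `V` and `K V` have the same dimension, so the injection `i` identifies
the kernel bundles and the two indices agree.

It remains to deform `K₀` to the identity through the positive injective operators
`P = (1 - t) K₀ + t`. For `s ≠ 0` the operator `B + isP` is invertible: the imaginary part of its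
quadratic form controls `‖P u‖`, hence the component of `u` along the finite dimensional kernel
of `B`, and the Fredholm estimate for `B` controls the rest. So the zeros of `s` give a compact set
off which the whole homotopy is invertible.
-/

namespace IndexBundle

theorem isInvertible_of_bijective {F G : Type*} [NormedAddCommGroup F] [NormedSpace ℂ F]
    [CompleteSpace F] [NormedAddCommGroup G] [NormedSpace ℂ G] [CompleteSpace G]
    {A : F →L[ℂ] G} (hA : Function.Bijective A) : A.IsInvertible :=
  ⟨.ofBijective A (LinearMap.ker_eq_bot.2 hA.1) (LinearMap.range_eq_top.2 hA.2), by ext; rfl⟩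

section Bundles

variable {Z : Type v} [TopologicalSpace Z]

theorem CBundle.exists_linear_local (E : CBundle.{u} Z) (z₀ : Z) :
    ∃ (n : ℕ) (U : Set Z) (φ : ∀ z, E.Fiber z →ₗ[ℂ] (Fin n → ℂ))
      (ψ : ∀ z, (Fin n → ℂ) →ₗ[ℂ] E.Fiber z), IsOpen U ∧ z₀ ∈ U ∧
      (∀ z ∈ U, ∀ u, ψ z (φ z u) = u) ∧ (∀ z ∈ U, ∀ f, φ z (ψ z f) = f) ∧
      ContinuousOn (fun p : E.Total => φ p.proj p.2) (TotalSpace.proj ⁻¹' U) ∧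
      ContinuousOn (fun q : Z × (Fin n → ℂ) => (⟨q.1, ψ q.1 q.2⟩ : E.Total))
        (U ×ˢ Set.univ) := by
  classical
  obtain ⟨n, U, φ, ψ, hU, hz₀, hl, hr, hφ, hψ⟩ := E.exists_local z₀
  let e : ∀ z ∈ U, E.Fiber z ≃ₗ[ℂ] (Fin n → ℂ) := fun z hz =>
    .ofBijective (φ z) ⟨Function.LeftInverse.injective (hl z hz),
      Function.RightInverse.surjective (hr z hz)⟩
  let χ : ∀ z, (Fin n → ℂ) →ₗ[ℂ] E.Fiber z := fun z =>
    if hz : z ∈ U then (e z hz).symm.toLinearMap else 0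
  have hχ : ∀ z ∈ U, ∀ f, χ z f = ψ z f := by
    intro z hz f
    have : (e z hz).symm f = ψ z f := (LinearEquiv.symm_apply_eq _).2 (hr z hz f).symm
    simpa [χ, hz] using this
  refine ⟨n, U, φ, χ, hU, hz₀, fun z hz u => ?_, fun z hz f => ?_, hφ, hψ.congr ?_⟩
  · rw [hχ z hz, hl z hz]
  · rw [hχ z hz, hr z hz]
  · exact fun q hq => congrArg (TotalSpace.mk q.1) (hχ q.1 hq.1 q.2)

theorem CBundle.Hom.continuous_symm_of_bijective {E E' : CBundle.{u} Z} (a : E.Hom E')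
    (ha : ∀ z, Function.Bijective (a.map z)) :
    Continuous fun p : E'.Total =>
      (⟨p.proj, (LinearEquiv.ofBijective (a.map p.proj) (ha p.proj)).symm p.2⟩ : E.Total) := by
  rw [continuous_iff_continuousAt]
  intro p₀
  obtain ⟨n, U, φ, ψ, hU, hz, hl, hr, -, hψ⟩ := E.exists_linear_local p₀.proj
  obtain ⟨n', U', φ', ψ', hU', hz', hl', hr', hφ', -⟩ := E'.exists_linear_local p₀.proj
  let g : Z → (Fin n → ℂ) →L[ℂ] (Fin n' → ℂ) := fun z =>
    LinearMap.toContinuousLinearMap (φ' z ∘ₗ a.map z ∘ₗ ψ z)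
  have hg : ContinuousOn g (U ∩ U') := by
    refine continuousOn_clm_apply.2 fun f => ?_
    have hψf : ContinuousOn (fun z => (⟨z, ψ z f⟩ : E.Total)) (U ∩ U') :=
      hψ.comp (f := fun z : Z => (z, f)) (by fun_prop) (fun z hz => ⟨hz.1, trivial⟩)
    exact hφ'.comp (a.continuous_map.comp_continuousOn hψf) (fun z hz => hz.2)
  have hginv : ∀ z ∈ U ∩ U', (g z).IsInvertible := fun z ⟨hU, hU'⟩ =>
    isInvertible_of_bijective <|
      (Function.bijective_iff_has_inverse.2 ⟨ψ' z, hl' z hU', hr' z hU'⟩).comp <|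
        (ha z).comp (Function.bijective_iff_has_inverse.2 ⟨φ z, hr z hU, hl z hU⟩)
  have hg_inverse : ContinuousOn (fun z => (g z).inverse) (U ∩ U') := fun z hz =>
    (hginv z hz).contDiffAt_map_inverse (n := 0) |>.continuousAt.comp_continuousWithinAt (hg z hz)
  have hUU' : IsOpen (TotalSpace.proj ⁻¹' (U ∩ U') : Set E'.Total) :=
    (hU.inter hU').preimage E'.continuous_proj
  have hlocal : ContinuousOn (fun p : E'.Total =>
      (⟨p.proj, ψ p.proj ((g p.proj).inverse (φ' p.proj p.2))⟩ : E.Total))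
      (TotalSpace.proj ⁻¹' (U ∩ U')) :=
    hψ.comp (f := fun p : E'.Total => (p.proj, (g p.proj).inverse (φ' p.proj p.2)))
      (E'.continuous_proj.continuousOn.prodMk
        ((hg_inverse.comp E'.continuous_proj.continuousOn fun p hp => hp).clm_apply
          (hφ'.mono fun p hp => hp.2))) (fun p hp => ⟨hp.1, trivial⟩)
  refine (hlocal.congr ?_).continuousAt (hUU'.mem_nhds ⟨hz, hz'⟩)
  rintro ⟨z, u⟩ hzU
  refine congrArg (TotalSpace.mk z) ((LinearEquiv.symm_apply_eq _).2 ?_)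
  exact (Function.LeftInverse.injective (hl' z hzU.2)
    ((hginv z hzU).self_apply_inverse (φ' z u))).symm

/-- A morphism of vector bundles which is bijective on the fibres, as an isomorphism. -/
noncomputable def CBundle.Hom.isoOfBijective {E E' : CBundle.{u} Z} (a : E.Hom E')
    (ha : ∀ z, Function.Bijective (a.map z)) : E.Iso E' where
  equiv z := LinearEquiv.ofBijective (a.map z) (ha z)
  continuous_equiv := a.continuous_map
  continuous_symm := a.continuous_symm_of_bijective ha

namespace Triple

theorem isomorphic_of_bijective {ξ η : Triple.{u} Z} (φ₀ : ξ.E₀.Hom η.E₀)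
    (φ₁ : ξ.E₁.Hom η.E₁) (h₀ : ∀ z, Function.Bijective (φ₀.map z))
    (h₁ : ∀ z, Function.Bijective (φ₁.map z))
    (h : ∀ z u, η.a.map z (φ₀.map z u) = φ₁.map z (ξ.a.map z u)) : ξ.Isomorphic η :=
  ⟨φ₀.isoOfBijective h₀, φ₁.isoOfBijective h₁, h⟩

/-- The identity of the product bundle with fibre `V`, as a trivial triple. -/
def product (Z : Type v) [TopologicalSpace Z] (V : Type u) [NormedAddCommGroup V]
    [NormedSpace ℂ V] [FiniteDimensional ℂ V] : Triple.{u} Z :=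
  ⟨CBundle.product Z V, CBundle.product Z V, ⟨fun _ => LinearMap.id, continuous_id⟩⟩

theorem isTrivial_product (V : Type u) [NormedAddCommGroup V] [NormedSpace ℂ V]
    [FiniteDimensional ℂ V] : (product Z V).IsTrivial :=
  Set.eq_empty_of_forall_notMem fun _ hz => hz Function.bijective_id

theorem supp_directSum_of_isTrivial (ξ : Triple.{u} Z) {η : Triple.{u} Z} (hη : η.IsTrivial) :
    (ξ.directSum η).supp = ξ.supp := by
  ext z
  have hz : Function.Bijective (η.a.map z) :=
    not_not.1 fun h => (Set.ext_iff.1 hη z).1 h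
  exact not_congr (Prod.map_bijective.trans (and_iff_left hz))

theorem Isomorphic.directSum_right {ξ η : Triple.{u} Z} (h : ξ.Isomorphic η)
    (ζ : Triple.{u} Z) : (ξ.directSum ζ).Isomorphic (η.directSum ζ) := by
  obtain ⟨φ₀, φ₁, hφ⟩ := h
  exact isomorphic_of_bijective
    (.directSum ⟨fun z => (φ₀.equiv z).toLinearMap, φ₀.continuous_equiv⟩
      ⟨fun _ => LinearMap.id, continuous_id⟩)
    (.directSum ⟨fun z => (φ₁.equiv z).toLinearMap, φ₁.continuous_equiv⟩
      ⟨fun _ => LinearMap.id, continuous_id⟩)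
    (fun z => (φ₀.equiv z).bijective.prodMap Function.bijective_id)
    (fun z => (φ₁.equiv z).bijective.prodMap Function.bijective_id)
    fun z u => Prod.ext (hφ z u.1) rfl

theorem Isomorphic.trans {ξ η ζ : Triple.{u} Z} (h : ξ.Isomorphic η) (h' : η.Isomorphic ζ) :
    ξ.Isomorphic ζ := by
  obtain ⟨φ₀, φ₁, hφ⟩ := h
  obtain ⟨ψ₀, ψ₁, hψ⟩ := h'
  refine isomorphic_of_bijective
    ⟨fun z => (ψ₀.equiv z).toLinearMap ∘ₗ (φ₀.equiv z).toLinearMap,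
      ψ₀.continuous_equiv.comp φ₀.continuous_equiv⟩
    ⟨fun z => (ψ₁.equiv z).toLinearMap ∘ₗ (φ₁.equiv z).toLinearMap,
      ψ₁.continuous_equiv.comp φ₁.continuous_equiv⟩
    (fun z => (ψ₀.equiv z).bijective.comp (φ₀.equiv z).bijective)
    (fun z => (ψ₁.equiv z).bijective.comp (φ₁.equiv z).bijective) fun z u => ?_
  exact (hψ z _).trans (congrArg (ψ₁.equiv z) (hφ z u))

end Triple

theorem CBundle.continuous_pullback_lift {Z' : Type v} [TopologicalSpace Z'] (f : C(Z', Z))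
    (E : CBundle.{u} Z) :
    Continuous fun p : (E.pullback f).Total => (⟨f p.proj, p.2⟩ : E.Total) := by
  have h : Continuous fun p : (E.pullback f).Total =>
    ((p.proj, ⟨f p.proj, p.2⟩) : Z' × E.Total) := continuous_induced_dom
  exact continuous_snd.comp h

theorem Triple.pullback_fst_pullback_slice_isomorphic (ξ : Triple.{u} Z) (t : unitInterval) :
    ((ξ.pullback .fst).pullback (slice Z t)).Isomorphic ξ := by
  have hlift (E : CBundle.{u} Z) : Continuous fun p : ((E.pullback .fst).pullback
      (slice Z t)).Total => (⟨p.proj, p.2⟩ : E.Total) :=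
    (E.continuous_pullback_lift .fst).comp ((E.pullback .fst).continuous_pullback_lift (slice Z t))
  exact isomorphic_of_bijective ⟨fun _ => LinearMap.id, hlift ξ.E₀⟩
    ⟨fun _ => LinearMap.id, hlift ξ.E₁⟩ (fun _ => Function.bijective_id)
    (fun _ => Function.bijective_id) fun _ _ => rfl

theorem K.mk_eq_of_isomorphic {Y : Set Z} {ξ η : L.{u} Z Y} (h : ξ.1.Isomorphic η.1) :
    K.mk ξ = K.mk η := by
  let ζ : Triple.{u} Z := .product Z PUnit
  have hζ : ζ.IsTrivial := Triple.isTrivial_product PUnit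
  have hsupp : ((ξ.1.directSum ζ).pullback .fst).supp = ξ.1.supp ×ˢ (Set.univ : Set unitInterval) :=
    (congrArg (Prod.fst ⁻¹' ·) (ξ.1.supp_directSum_of_isTrivial hζ)).trans Set.prod_univ.symm
  refine Quot.sound ⟨ζ, ζ, hζ, hζ, (ξ.1.directSum ζ).pullback .fst, ?_,
    Triple.pullback_fst_pullback_slice_isomorphic _ 0,
    (Triple.pullback_fst_pullback_slice_isomorphic _ 1).trans (h.directSum_right ζ)⟩
  rw [Triple.IsAdmissible, hsupp]
  exact ⟨ξ.2.1.prod isCompact_univ, fun p hp hY => ξ.2.2 hp.1 hY.1⟩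

end Bundles

section Stabilization

theorem isQuasiInverse_inl_fst {𝕜 V M : Type*} [Field 𝕜] [AddCommGroup V] [Module 𝕜 V]
    [AddCommGroup M] [Module 𝕜 M] [FiniteDimensional 𝕜 M] :
    (LinearMap.inl 𝕜 V M).IsQuasiInverse (LinearMap.fst 𝕜 V M) := by
  refine ⟨?_, by rw [LinearMap.IsRightQuasiInverse, LinearMap.fst_comp_inl]⟩
  have hsub : LinearMap.inl 𝕜 V M ∘ₗ LinearMap.fst 𝕜 V M - LinearMap.id =
      -LinearMap.inr 𝕜 V M ∘ₗ LinearMap.snd 𝕜 V M := by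
    ext x <;> simp
  refine LinearMap.FiniteRangeSetoid.equiv_iff_hasNoetherianRange.2 (hsub ▸ ?_)
  exact (LinearMap.HasNoetherianRange.of_isNoetherian_dom (f := -LinearMap.inr 𝕜 V M)).comp_right _

theorem index_fst {𝕜 V M : Type*} [Field 𝕜] [AddCommGroup V] [Module 𝕜 V]
    [AddCommGroup M] [Module 𝕜 M] :
    (LinearMap.fst 𝕜 V M).index = Module.finrank 𝕜 M := by
  rw [LinearMap.index_of_surjective LinearMap.fst_surjective, LinearMap.ker_fst,
    LinearMap.finrank_range_of_inj LinearMap.inr_injective]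

theorem isFredholm_inl {W M : Type*} [NormedAddCommGroup W] [NormedSpace ℂ W]
    [NormedAddCommGroup M] [NormedSpace ℂ M] [FiniteDimensional ℂ M] :
    (ContinuousLinearMap.inl ℂ W M).IsFredholm :=
  .of_isQuasiInverse (v := .fst ℂ W M) isQuasiInverse_inl_fst.symm

theorem isFredholm_fst {W M : Type*} [NormedAddCommGroup W] [NormedSpace ℂ W]
    [NormedAddCommGroup M] [NormedSpace ℂ M] [FiniteDimensional ℂ M] :
    (ContinuousLinearMap.fst ℂ W M).IsFredholm :=
  .of_isQuasiInverse (v := .inl ℂ W M) isQuasiInverse_inl_fst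

section Composition

variable {F G H : Type*} [NormedAddCommGroup F] [NormedSpace ℂ F] [NormedAddCommGroup G]
  [NormedSpace ℂ G] [NormedAddCommGroup H] [NormedSpace ℂ H] {S : F →L[ℂ] G} {T : G →L[ℂ] H}

theorem isFredholm_comp (hS : S.IsFredholm) (hT : T.IsFredholm) : (T ∘L S).IsFredholm := by
  obtain ⟨v, hv⟩ := hS.exists_isQuasiInverse
  obtain ⟨w, hw⟩ := hT.exists_isQuasiInverse
  exact .of_isQuasiInverse (v := v ∘L w) (hv.comp hw)

theorem index_comp_of_isFredholm (hS : S.IsFredholm) (hT : T.IsFredholm) :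
    (T ∘L S).toLinearMap.index = T.toLinearMap.index + S.toLinearMap.index := by
  have := hS.finite_ker
  have := hT.finite_ker
  have : FiniteDimensional ℂ (G ⧸ S.range) := hS.finite_coker
  have : FiniteDimensional ℂ (H ⧸ T.range) := hT.finite_coker
  exact LinearMap.index_comp T.toLinearMap

end Composition

variable {Z : Type v} [TopologicalSpace Z]
variable {W F M : Type u} [NormedAddCommGroup W] [NormedSpace ℂ W]
  [NormedAddCommGroup F] [NormedSpace ℂ F] [NormedAddCommGroup M] [NormedSpace ℂ M]

/-- The stabilisation `(w, m) ↦ (S w - φ m, m)` of `S` by `φ`. When `S` and `φ` together span `F`,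
the fixed subspace `{0} × M` is transversal to it, whatever the image of `φ`. -/
noncomputable def stabilization (S : W →L[ℂ] F) (φ : M →L[ℂ] F) : W × M →L[ℂ] F × M :=
  (S ∘L .fst ℂ W M - φ ∘L .snd ℂ W M).prod (.snd ℂ W M)

theorem stabilization_apply (S : W →L[ℂ] F) (φ : M →L[ℂ] F) (p : W × M) :
    stabilization S φ p = (S p.1 - φ p.2, p.2) := rfl

theorem continuous_stabilization {T : Z → W →L[ℂ] F} {φ : Z → M →L[ℂ] F} (hT : Continuous T)
    (hφ : Continuous φ) : Continuous fun z => stabilization (T z) (φ z) :=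
  (ContinuousLinearMap.prodₗᵢ ℂ).continuous.comp
    (((hT.clm_comp continuous_const).sub (hφ.clm_comp continuous_const)).prodMk continuous_const)

theorem isInvertible_stabilization {S : W →L[ℂ] F} (hS : S.IsInvertible) (φ : M →L[ℂ] F) :
    (stabilization S φ).IsInvertible := by
  obtain ⟨e, rfl⟩ := hS
  refine .of_inverse (g := (e.symm ∘L (.fst ℂ F M + φ ∘L .snd ℂ F M)).prod (.snd ℂ F M)) ?_ ?_ <;>
    ext x <;> simp [stabilization_apply]

theorem fst_comp_stabilization_comp_inl (S : W →L[ℂ] F) (φ : M →L[ℂ] F) :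
    .fst ℂ F M ∘L stabilization S φ ∘L .inl ℂ W M = S := by
  ext w
  simp [stabilization_apply]

section FiniteDimensional

variable [FiniteDimensional ℂ M]

theorem isFredholm_stabilization {S : W →L[ℂ] F} (hS : S.IsFredholm) (φ : M →L[ℂ] F) :
    (stabilization S φ).IsFredholm := by
  obtain ⟨v, hv⟩ := hS.exists_isQuasiInverse
  rw [← fst_comp_stabilization_comp_inl S φ] at hv
  exact .of_isQuasiInverse (v := .inl ℂ W M ∘L v ∘L .fst ℂ F M)
    (.of_comp_left isQuasiInverse_inl_fst.symm (.of_comp_right isQuasiInverse_inl_fst hv))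

theorem index_stabilization {S : W →L[ℂ] F} (hS : S.IsFredholm) (φ : M →L[ℂ] F) :
    (stabilization S φ).toLinearMap.index = S.toLinearMap.index := by
  have hfst (G : Type u) [NormedAddCommGroup G] [NormedSpace ℂ G] :
      (ContinuousLinearMap.fst ℂ G M).toLinearMap.index = Module.finrank ℂ M := index_fst
  have hinl : (ContinuousLinearMap.inl ℂ W M).toLinearMap.index = -Module.finrank ℂ M := by
    have h := index_comp_of_isFredholm (isFredholm_inl (W := W) (M := M)) isFredholm_fst
    rw [ContinuousLinearMap.fst_comp_inl, ContinuousLinearMap.coe_id, LinearMap.index_id, hfst] at h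
    lia
  have hfred := isFredholm_stabilization hS φ
  have h := index_comp_of_isFredholm (isFredholm_comp isFredholm_inl hfred) isFredholm_fst
  rw [fst_comp_stabilization_comp_inl, index_comp_of_isFredholm isFredholm_inl hfred, hinl, hfst]
    at h
  lia

theorem isFredholmMorphism_stabilization {Y : Set Z} {T : Z → W →L[ℂ] F}
    (hT : IsFredholmMorphism Y T) {φ : Z → M →L[ℂ] F} (hφ : Continuous φ) :
    IsFredholmMorphism Y fun z => stabilization (T z) (φ z) where
  continuous := continuous_stabilization hT.continuous hφ
  fredholm z := isFredholm_stabilization (hT.fredholm z) _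
  index_zero z := (index_stabilization (hT.fredholm z) _).trans (hT.index_zero z)
  invertible_off_compact := by
    obtain ⟨C, hC, hinv⟩ := hT.invertible_off_compact
    exact ⟨C, hC, fun z hz => isInvertible_stabilization (hinv z hz) _⟩
  invertible_on z hz := isInvertible_stabilization (hT.invertible_on z hz) _

end FiniteDimensional

theorem isTransversal_stabilization {Z : Type*} {T : Z → W →L[ℂ] F} {φ : Z → M →L[ℂ] F}
    (h : ∀ z, LinearMap.range (T z).toLinearMap ⊔ LinearMap.range (φ z).toLinearMap = ⊤) :
    IsTransversal (fun z => stabilization (T z) (φ z)) (LinearMap.range (LinearMap.inr ℂ F M)) := by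
  refine fun z => eq_top_iff.2 fun ⟨f, m⟩ _ => ?_
  obtain ⟨_, ⟨w, rfl⟩, _, ⟨n, rfl⟩, rfl⟩ := Submodule.mem_sup.1 (h z ▸ Submodule.mem_top (x := f))
  exact Submodule.mem_sup.2 ⟨stabilization (T z) (φ z) (w, -n), ⟨_, rfl⟩, (0, m + n), ⟨m + n, rfl⟩,
    by simp [stabilization_apply]⟩

section SplitSubspace

variable {N : Type u} [NormedAddCommGroup N] [NormedSpace ℂ N] {V : Submodule ℂ F}

theorem mem_comap_stabilization_iff {S : W →L[ℂ] F} {e : M ≃L[ℂ] V × N} {x : W × M} :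
    x ∈ (LinearMap.range (LinearMap.inr ℂ F M)).comap
      (stabilization S (V.subtypeL ∘L .fst ℂ V N ∘L e)).toLinearMap ↔ S x.1 = (e x.2).1 := by
  simp [stabilization_apply, sub_eq_zero, eq_comm (a := (0 : F))]

/-- If `φ` is the projection of `M ≃ V × N` onto `V ⊆ F`, then the fibre of the index bundle of
the stabilisation of `S` by `φ` is `E(S, V) × N`. -/
def comapStabilizationEquiv (S : W →L[ℂ] F) (e : M ≃L[ℂ] V × N) :
    (LinearMap.range (LinearMap.inr ℂ F M)).comap
      (stabilization S (V.subtypeL ∘L .fst ℂ V N ∘L e)).toLinearMap ≃ₗ[ℂ]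
      V.comap S.toLinearMap × N where
  toFun x := (⟨x.1.1, by
    simpa only [Submodule.mem_comap, ContinuousLinearMap.coe_coe,
      mem_comap_stabilization_iff.1 x.2] using (e x.1.2).1.2⟩, (e x.1.2).2)
  invFun y := ⟨(y.1.1, e.symm (⟨S y.1.1, y.1.2⟩, y.2)), mem_comap_stabilization_iff.2 (by simp)⟩
  map_add' x y := by ext <;> simp
  map_smul' c x := by ext <;> simp
  left_inv := by
    rintro ⟨⟨w, m⟩, hx⟩
    refine Subtype.ext (Prod.ext rfl (e.symm_apply_eq.2 (Prod.ext (Subtype.ext ?_) rfl)))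
    exact mem_comap_stabilization_iff.1 hx
  right_inv y := by ext <;> simp

variable {Z' : Type v} [TopologicalSpace Z'] [CompleteSpace W] [CompleteSpace F] [CompleteSpace M]

theorem indexTriple_stabilization_isomorphic [FiniteDimensional ℂ M] [FiniteDimensional ℂ N]
    {Y : Set Z} {Y' : Set Z'} {T : Z → W →L[ℂ] F} {A : Z' → W × M →L[ℂ] F × M}
    (hT : IsFredholmMorphism Y T) (hA : IsFredholmMorphism Y' A) [FiniteDimensional ℂ V]
    (hV : IsTransversal T V) (hA' : IsTransversal A (LinearMap.range (LinearMap.inr ℂ F M)))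
    (e : M ≃L[ℂ] V × N) (f : C(Z, Z'))
    (hf : ∀ z, A (f z) = stabilization (T z) (V.subtypeL ∘L .fst ℂ V N ∘L e)) :
    ((indexTriple hA _ hA').pullback f).Isomorphic
      ((indexTriple hT V hV).directSum (Triple.product Z N)) := by
  let α (z : Z) : (LinearMap.range (LinearMap.inr ℂ F M)).comap (A (f z)).toLinearMap ≃ₗ[ℂ]
      V.comap (T z).toLinearMap × N :=
    LinearEquiv.ofEq _ _ (by rw [hf z]) ≪≫ₗ comapStabilizationEquiv (T z) e
  let β : LinearMap.range (LinearMap.inr ℂ F M) →ₗ[ℂ] V × N :=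
    e.toLinearMap ∘ₗ LinearMap.snd ℂ F M ∘ₗ Submodule.subtype _
  have hβ : Function.Bijective β := by
    refine ⟨?_, fun y => ⟨⟨_, e.symm y, rfl⟩, e.apply_symm_apply y⟩⟩
    rintro ⟨_, m, rfl⟩ ⟨_, m', rfl⟩ h
    exact Subtype.ext (congrArg (Prod.mk 0) (e.injective h))
  refine Triple.isomorphic_of_bijective ⟨fun z => (α z).toLinearMap, ?_⟩ ⟨fun _ => β, ?_⟩
    (fun z => by exact (α z).bijective) (fun _ => hβ) ?_
  · have h : Continuous fun p : ((kernelBundle hA _ hA').pullback f).Total =>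
        ((f p.proj, p.2.1) : Z' × (W × M)) :=
      continuous_induced_dom.comp ((kernelBundle hA _ hA').continuous_pullback_lift f)
    have hproj := ((kernelBundle hA _ hA').pullback f).continuous_proj
    have hw := h.snd.fst
    have hn := (e.continuous.comp h.snd.snd).snd
    exact continuous_induced_rng.2 ((continuous_induced_rng.2 (hproj.prodMk hw)).prodMk
      (continuous_induced_rng.2 (hproj.prodMk hn)))
  · have h : Continuous fun p : ((CBundle.product Z' _).pullback f).Total =>
        ((f p.proj, p.2) : Z' × LinearMap.range (LinearMap.inr ℂ F M)) :=
      continuous_induced_dom.comp ((CBundle.product Z' _).continuous_pullback_lift f)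
    have hproj := ((CBundle.product Z' (LinearMap.range (LinearMap.inr ℂ F M))).pullback
      f).continuous_proj
    have hvn := e.continuous.comp (continuous_subtype_val.comp h.snd).snd
    exact continuous_induced_rng.2 ((continuous_induced_rng.2 (hproj.prodMk hvn.fst)).prodMk
      (continuous_induced_rng.2 (hproj.prodMk hvn.snd)))
  · rintro z ⟨x, hx⟩
    have hx' : T z x.1 = (e x.2).1 := mem_comap_stabilization_iff.1 (hf z ▸ hx)
    have hsnd : (A (f z) x).2 = x.2 := congrArg (fun L => (L x).2) (hf z)
    have hA_apply : e (A (f z) x).2 = (⟨T z x.1, hx' ▸ (e x.2).1.2⟩, (e x.2).2) := by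
      rw [hsnd]
      exact Prod.ext (Subtype.ext hx'.symm) rfl
    exact hA_apply.symm

end SplitSubspace

end Stabilization

section Homotopy

variable {Z : Type v} [TopologicalSpace Z] {Y : Set Z}
variable {W F : Type u} [NormedAddCommGroup W] [NormedSpace ℂ W]
  [NormedAddCommGroup F] [NormedSpace ℂ F]

theorem range_sup_range_smul_add_smul_eq_top {S : W →L[ℂ] F} {V V' : Submodule ℂ F}
    (hV : LinearMap.range S.toLinearMap ⊔ V = ⊤) (hV' : LinearMap.range S.toLinearMap ⊔ V' = ⊤)
    {a b : ℂ} (hab : a ≠ 0 ∨ b ≠ 0) :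
    LinearMap.range S.toLinearMap ⊔ LinearMap.range
      (a • V.subtypeL ∘L .fst ℂ V V' + b • V'.subtypeL ∘L .snd ℂ V V').toLinearMap = ⊤ := by
  rw [eq_top_iff]
  rcases hab with ha | hb
  · exact hV.symm.le.trans
      (sup_le_sup_left (fun v hv => ⟨(a⁻¹ • ⟨v, hv⟩, 0), by simp [smul_inv_smul₀ ha]⟩) _)
  · exact hV'.symm.le.trans
      (sup_le_sup_left (fun v hv => ⟨(0, b⁻¹ • ⟨v, hv⟩), by simp [smul_inv_smul₀ hb]⟩) _)

theorem IsFredholmMorphism.comp_fst {T : Z → W →L[ℂ] F} (hT : IsFredholmMorphism Y T) :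
    IsFredholmMorphism (Y ×ˢ Set.univ) fun p : Z × unitInterval => T p.1 where
  continuous := hT.continuous.comp continuous_fst
  fredholm p := hT.fredholm p.1
  index_zero p := hT.index_zero p.1
  invertible_off_compact := by
    obtain ⟨C, hC, hinv⟩ := hT.invertible_off_compact
    exact ⟨C ×ˢ Set.univ, hC.prod isCompact_univ, fun p hp => hinv p.1 fun h => hp ⟨h, trivial⟩⟩
  invertible_on p hp := hT.invertible_on p.1 hp.1

variable [CompleteSpace W] [CompleteSpace F] {T₀ T₁ : Z → W →L[ℂ] F}

theorem indexClass_eq_of_homotopy {T : Z × unitInterval → W →L[ℂ] F}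
    (hT : IsFredholmMorphism (Y ×ˢ Set.univ) T) {V V' : Submodule ℂ F} [FiniteDimensional ℂ V]
    [FiniteDimensional ℂ V'] (hV : IsTransversal T V) (hV' : IsTransversal T V')
    (h₀ : IsFredholmMorphism Y T₀) (h₁ : IsFredholmMorphism Y T₁)
    (hT₀ : ∀ z, T (z, 0) = T₀ z) (hT₁ : ∀ z, T (z, 1) = T₁ z)
    (hV₀ : IsTransversal T₀ V) (hV₁ : IsTransversal T₁ V') :
    indexClass h₀ V hV₀ = indexClass h₁ V' hV₁ := by
  let φ (p : Z × unitInterval) : V × V' →L[ℂ] F :=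
    (1 - (p.2 : ℂ)) • V.subtypeL ∘L .fst ℂ V V' + (p.2 : ℂ) • V'.subtypeL ∘L .snd ℂ V V'
  have hφ : Continuous φ := by fun_prop
  have hA := isFredholmMorphism_stabilization hT hφ
  have hA' := isTransversal_stabilization fun p =>
    range_sup_range_smul_add_smul_eq_top (hV p) (hV' p) (a := 1 - (p.2 : ℂ)) (b := (p.2 : ℂ))
      (by by_contra! h; simp [h.2] at h)
  refine Quot.sound ⟨.product Z V', .product Z V, Triple.isTrivial_product _,
    Triple.isTrivial_product _, indexTriple hA _ hA', indexTriple_isAdmissible hA _ hA', ?_, ?_⟩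
  · refine indexTriple_stabilization_isomorphic h₀ hA hV₀ hA' (.refl ℂ _) (Triple.slice Z 0)
      fun z => ?_
    exact congrArg₂ stabilization (hT₀ z) (by ext <;> simp [φ, Triple.slice])
  · refine indexTriple_stabilization_isomorphic h₁ hA hV₁ hA' (.prodComm ℂ V V') (Triple.slice Z 1)
      fun z => ?_
    exact congrArg₂ stabilization (hT₁ z) (by ext <;> simp [φ, Triple.slice])

theorem ind_eq_indexClass {T : Z → W →L[ℂ] F} (hT : IsFredholmMorphism Y T) (V : Submodule ℂ F)
    [FiniteDimensional ℂ V] (hV : IsTransversal T V) : ind hT = indexClass hT V hV := by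
  obtain ⟨_, hV₀⟩ := (exists_transversal hT).choose_spec
  exact indexClass_eq_of_homotopy hT.comp_fst (fun p => hV₀ p.1) (fun p => hV p.1) hT hT
    (fun _ => rfl) (fun _ => rfl) hV₀ hV

theorem ind_eq_of_homotopy {T : Z × unitInterval → W →L[ℂ] F}
    (hT : IsFredholmMorphism (Y ×ˢ Set.univ) T)
    (h₀ : IsFredholmMorphism Y T₀) (h₁ : IsFredholmMorphism Y T₁)
    (hT₀ : ∀ z, T (z, 0) = T₀ z) (hT₁ : ∀ z, T (z, 1) = T₁ z) : ind h₀ = ind h₁ := by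
  obtain ⟨V, _, hV⟩ := exists_transversal hT
  have hV₀ : IsTransversal T₀ V := fun z => hT₀ z ▸ hV (z, 0)
  have hV₁ : IsTransversal T₁ V := fun z => hT₁ z ▸ hV (z, 1)
  rw [ind_eq_indexClass h₀ V hV₀, ind_eq_indexClass h₁ V hV₁]
  exact indexClass_eq_of_homotopy hT hV hV h₀ h₁ hT₀ hT₁ hV₀ hV₁

end Homotopy

section Intertwining

theorem finrank_comap_eq_index_add {𝕜 W F : Type*} [Field 𝕜] [AddCommGroup W] [Module 𝕜 W]
    [AddCommGroup F] [Module 𝕜 F] {T : W →ₗ[𝕜] F} [FiniteDimensional 𝕜 (LinearMap.ker T)]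
    [FiniteDimensional 𝕜 (F ⧸ LinearMap.range T)] {V : Submodule 𝕜 F} [FiniteDimensional 𝕜 V]
    (hV : LinearMap.range T ⊔ V = ⊤) :
    (Module.finrank 𝕜 (V.comap T) : ℤ) = T.index + Module.finrank 𝕜 V := by
  have hsurj : Function.Surjective (V.mkQ ∘ₗ T) := by
    rw [← LinearMap.range_eq_top, LinearMap.range_comp, ← V.range_mkQ,
      V.mkQ.range_eq_map, ← hV, Submodule.map_sup, Submodule.mkQ_map_self, sup_bot_eq]
  have hker : LinearMap.ker (V.mkQ ∘ₗ T) = V.comap T := by rw [LinearMap.ker_comp, V.ker_mkQ]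
  have : FiniteDimensional 𝕜 (LinearMap.ker V.mkQ) := by rwa [V.ker_mkQ]
  have : FiniteDimensional 𝕜 ((F ⧸ V) ⧸ LinearMap.range V.mkQ) := by
    rw [V.range_mkQ]; infer_instance
  have h := LinearMap.index_comp V.mkQ (f := T)
  rw [LinearMap.index_of_surjective hsurj, LinearMap.index_of_surjective V.mkQ_surjective, hker,
    V.ker_mkQ] at h
  lia

variable {Z : Type v} [TopologicalSpace Z]
variable {W F W' F' : Type u} [NormedAddCommGroup W] [NormedSpace ℂ W]
  [NormedAddCommGroup F] [NormedSpace ℂ F] [NormedAddCommGroup W'] [NormedSpace ℂ W']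
  [NormedAddCommGroup F'] [NormedSpace ℂ F']

theorem range_sup_map_eq_top_of_intertwining {S : W →L[ℂ] F} {S' : W' →L[ℂ] F'}
    {a : W →L[ℂ] W'} {b : F →L[ℂ] F'} (hb : DenseRange b) (hab : ∀ w, S' (a w) = b (S w))
    (hcl : IsClosed (LinearMap.range S'.toLinearMap : Set F')) {V : Submodule ℂ F}
    [FiniteDimensional ℂ V] (hV : LinearMap.range S.toLinearMap ⊔ V = ⊤) :
    LinearMap.range S'.toLinearMap ⊔ V.map b.toLinearMap = ⊤ := by
  have hclosed := Submodule.isClosed_sup_finiteDimensional _ (V.map b.toLinearMap) hcl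
  have hle : LinearMap.range b.toLinearMap ≤
      LinearMap.range S'.toLinearMap ⊔ V.map b.toLinearMap := by
    rw [LinearMap.range_eq_map, ← hV, Submodule.map_sup]
    refine sup_le_sup_right ?_ _
    rintro _ ⟨_, ⟨w, rfl⟩, rfl⟩
    exact ⟨a w, hab w⟩
  exact eq_top_iff.2 fun x _ => hclosed.closure_subset_iff.2 hle (hb x)

theorem finrank_comap_eq_finrank {S : W →L[ℂ] F} (hS : S.IsFredholm)
    (hS₀ : S.toLinearMap.index = 0) {V : Submodule ℂ F} [FiniteDimensional ℂ V]
    (hV : LinearMap.range S.toLinearMap ⊔ V = ⊤) :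
    Module.finrank ℂ (V.comap S.toLinearMap) = Module.finrank ℂ V := by
  have := hS.finite_ker
  have : FiniteDimensional ℂ (F ⧸ S.range) := hS.finite_coker
  simpa [hS₀] using finrank_comap_eq_index_add hV

variable [CompleteSpace W] [CompleteSpace F] [CompleteSpace W'] [CompleteSpace F']

theorem ind_eq_of_intertwining {Y : Set Z} {T : Z → W →L[ℂ] F} {T' : Z → W' →L[ℂ] F'}
    (hT : IsFredholmMorphism Y T) (hT' : IsFredholmMorphism Y T')
    (a : W →L[ℂ] W') (b : F →L[ℂ] F') (ha : Function.Injective a) (hb : Function.Injective b)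
    (hbd : DenseRange b) (hab : ∀ z w, T' z (a w) = b (T z w)) : ind hT = ind hT' := by
  obtain ⟨V, _, hV⟩ := exists_transversal hT
  have hV' : IsTransversal T' (V.map b.toLinearMap) := fun z =>
    range_sup_map_eq_top_of_intertwining hbd (hab z) (hT'.fredholm z).isClosed_range (hV z)
  rw [ind_eq_indexClass hT V hV, ind_eq_indexClass hT' _ hV']
  let α (z : Z) : V.comap (T z).toLinearMap →ₗ[ℂ]
      (V.map b.toLinearMap).comap (T' z).toLinearMap :=
    a.toLinearMap.restrict fun w hw => ⟨T z w, hw, (hab z w).symm⟩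
  let β : V ≃ₗ[ℂ] V.map b.toLinearMap := V.equivMapOfInjective b.toLinearMap hb
  have hα (z : Z) : Function.Bijective (α z) := by
    have hinj : Function.Injective (α z) := fun v w h => Subtype.ext (ha (congrArg Subtype.val h))
    have := finiteDimensional_comap (hT.fredholm z) V
    have := finiteDimensional_comap (hT'.fredholm z) (V.map b.toLinearMap)
    refine ⟨hinj, (LinearMap.injective_iff_surjective_of_finrank_eq_finrank ?_).1 hinj⟩
    rw [finrank_comap_eq_finrank (hT.fredholm z) (hT.index_zero z) (hV z),
      finrank_comap_eq_finrank (hT'.fredholm z) (hT'.index_zero z) (hV' z)]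
    exact β.finrank_eq
  refine K.mk_eq_of_isomorphic (Triple.isomorphic_of_bijective ⟨α, ?_⟩
    ⟨fun _ => β.toLinearMap, ?_⟩ hα (fun _ => by exact β.bijective) ?_)
  · have h : Continuous fun p : (kernelBundle hT V hV).Total => ((p.proj, p.2.1) : Z × W) :=
      continuous_induced_dom
    exact continuous_induced_rng.2 (h.fst.prodMk (a.continuous.comp h.snd))
  · have h : Continuous fun p : (CBundle.product Z V).Total => ((p.proj, p.2) : Z × V) :=
      continuous_induced_dom
    exact continuous_induced_rng.2 (h.fst.prodMk
      ((b.continuous.comp (continuous_subtype_val.comp h.snd)).subtype_mk _))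
  · exact fun z w => Subtype.ext (hab z w.1)

end Intertwining

section SelfAdjoint

theorem exists_norm_le_of_isFredholm {E F G : Type*} [NormedAddCommGroup E] [NormedSpace ℂ E]
    [CompleteSpace E] [NormedAddCommGroup F] [NormedSpace ℂ F] [CompleteSpace F]
    [NormedAddCommGroup G] [NormedSpace ℂ G] {B : E →L[ℂ] F} (hB : B.IsFredholm) {k : E →L[ℂ] G}
    (hk : Function.Injective k) : ∃ κ ≥ 0, ∀ u, ‖u‖ ≤ κ * (‖B u‖ + ‖k u‖) := by
  have := hB.finite_ker
  have : CompleteSpace B.range := hB.isClosed_range.completeSpace_coe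
  obtain ⟨a, ha, hpre⟩ := B.rangeRestrict.exists_preimage_norm_le B.surjective_rangeRestrict
  obtain ⟨b, -, hb⟩ := (k.toLinearMap ∘ₗ B.ker.subtype).exists_antilipschitzWith
    (LinearMap.ker_eq_bot.2 (hk.comp Subtype.val_injective))
  refine ⟨max (a + b * ‖k‖ * a) b, by positivity, fun u => ?_⟩
  obtain ⟨x, hx, hxle⟩ := hpre ⟨B u, u, rfl⟩
  have hBx : B x = B u := congrArg Subtype.val hx
  have hker : u - x ∈ B.ker := by simp [hBx]
  have hkle : ‖u - x‖ ≤ b * ‖k (u - x)‖ := by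
    simpa [-map_sub] using hb.le_mul_norm_sub ⟨u - x, hker⟩ 0
  have hxle' : ‖x‖ ≤ a * ‖B u‖ := hxle
  calc ‖u‖ = ‖x + (u - x)‖ := by rw [add_sub_cancel]
    _ ≤ ‖x‖ + ‖u - x‖ := norm_add_le _ _
    _ ≤ ‖x‖ + b * (‖k u‖ + ‖k‖ * ‖x‖) := by
      gcongr
      refine hkle.trans ?_
      rw [map_sub]
      gcongr
      exact (norm_sub_le _ _).trans (by gcongr; exact k.le_opNorm x)
    _ ≤ a * ‖B u‖ + b * (‖k u‖ + ‖k‖ * (a * ‖B u‖)) := by gcongr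
    _ = (a + b * ‖k‖ * a) * ‖B u‖ + b * ‖k u‖ := by ring
    _ ≤ max (a + b * ‖k‖ * a) b * (‖B u‖ + ‖k u‖) := by
      rw [mul_add]
      gcongr
      exacts [le_max_left _ _, le_max_right _ _]

variable {E : Type*} [NormedAddCommGroup E] [InnerProductSpace ℂ E] [CompleteSpace E]
  {B P : E →L[ℂ] E}

theorem norm_apply_sq_le_of_isPositive (hP : P.IsPositive) (u : E) :
    ‖P u‖ ^ 2 ≤ ‖P‖ * P.reApplyInnerSelf u := by
  obtain ⟨S, rfl⟩ := CStarAlgebra.nonneg_iff_eq_star_mul_self.1 (P.nonneg_iff_isPositive.2 hP)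
  have hnorm : ‖star S * S‖ = ‖S‖ ^ 2 := by rw [CStarRing.norm_star_mul_self, sq]
  have hinner : (star S * S).reApplyInnerSelf u = ‖S u‖ ^ 2 := by
    rw [ContinuousLinearMap.reApplyInnerSelf_apply, mul_apply_eq_comp,
      ContinuousLinearMap.star_eq_adjoint, ContinuousLinearMap.adjoint_inner_left,
      inner_self_eq_norm_sq]
  rw [hnorm, hinner, ← mul_pow]
  gcongr
  calc ‖star S (S u)‖ ≤ ‖star S‖ * ‖S u‖ := (star S).le_opNorm _
    _ = ‖S‖ * ‖S u‖ := by rw [norm_star]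

theorem abs_mul_reApplyInnerSelf_le (hB : IsSelfAdjoint B) (hP : P.IsPositive) (s : ℝ) (u : E) :
    |s| * P.reApplyInnerSelf u ≤ ‖(B + (Complex.I * s) • P) u‖ * ‖u‖ := by
  have hBim : (inner ℂ (B u) u).im = 0 := hB.isSymmetric.im_inner_apply_self u
  have hPim : (inner ℂ (P u) u).im = 0 := hP.isSymmetric.im_inner_apply_self u
  have him : (inner ℂ ((B + (Complex.I * s) • P) u) u).im = -(s * P.reApplyInnerSelf u) := by
    simp [hBim, hPim, ContinuousLinearMap.reApplyInnerSelf_apply, mul_comm s]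
  have hnonneg : 0 ≤ P.reApplyInnerSelf u := hP.2 u
  calc |s| * P.reApplyInnerSelf u = |(inner ℂ ((B + (Complex.I * s) • P) u) u).im| := by
        rw [him, abs_neg, abs_mul, abs_of_nonneg hnonneg]
    _ ≤ ‖inner ℂ ((B + (Complex.I * s) • P) u) u‖ := Complex.abs_im_le_norm _
    _ ≤ _ := norm_inner_le_norm _ _

theorem exists_norm_le_mul_norm_add_smul (hB : IsSelfAdjoint B) (hF : B.IsFredholm)
    (hP : P.IsPositive) (hPinj : Function.Injective P) {s : ℝ} (hs : s ≠ 0) :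
    ∃ c ≥ 0, ∀ u, ‖u‖ ≤ c * ‖(B + (Complex.I * s) • P) u‖ := by
  obtain ⟨κ, hκ, hle⟩ := exists_norm_le_of_isFredholm hF hPinj
  let M := ‖P‖ / |s|
  let a := κ * (1 + |s|)
  refine ⟨2 * κ + a ^ 2 * M, by positivity, fun u => ?_⟩
  let T := B + (Complex.I * s) • P
  have hPu : ‖P u‖ ^ 2 ≤ M * ‖T u‖ * ‖u‖ := by
    have : 0 < |s| := abs_pos.2 hs
    calc ‖P u‖ ^ 2 ≤ ‖P‖ * P.reApplyInnerSelf u := norm_apply_sq_le_of_isPositive hP u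
      _ = M * (|s| * P.reApplyInnerSelf u) := by simp only [M]; field_simp
      _ ≤ M * (‖T u‖ * ‖u‖) :=
        mul_le_mul_of_nonneg_left (abs_mul_reApplyInnerSelf_le hB hP s u) (by positivity)
      _ = M * ‖T u‖ * ‖u‖ := by ring
  have hBu : ‖B u‖ ≤ ‖T u‖ + |s| * ‖P u‖ := by
    have h : B u = T u - (Complex.I * s) • P u := by simp [T]
    calc ‖B u‖ ≤ ‖T u‖ + ‖(Complex.I * s) • P u‖ := h ▸ norm_sub_le _ _
      _ = ‖T u‖ + |s| * ‖P u‖ := by simp [norm_smul]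
  have hAMGM : a * ‖P u‖ ≤ (‖u‖ + a ^ 2 * M * ‖T u‖) / 2 := by
    refine abs_le_of_sq_le_sq' ?_ (by positivity) |>.2
    nlinarith [sq_nonneg (‖u‖ - a ^ 2 * M * ‖T u‖), mul_le_mul_of_nonneg_left hPu (sq_nonneg a)]
  have hu : ‖u‖ ≤ κ * ‖T u‖ + a * ‖P u‖ := by
    refine (hle u).trans ?_
    simp only [a]
    nlinarith
  change ‖u‖ ≤ (2 * κ + a ^ 2 * M) * ‖T u‖
  linarith

theorem isInvertible_add_smul (hB : IsSelfAdjoint B) (hF : B.IsFredholm) (hP : P.IsPositive)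
    (hPinj : Function.Injective P) {s : ℝ} (hs : s ≠ 0) :
    (B + (Complex.I * s) • P).IsInvertible := by
  obtain ⟨c, hc, hle⟩ := exists_norm_le_mul_norm_add_smul hB hF hP hPinj hs
  obtain ⟨c', -, hle'⟩ := exists_norm_le_mul_norm_add_smul hB hF hP hPinj (neg_ne_zero.2 hs)
  refine isInvertible_of_bijective
    ((ContinuousLinearMap.bijective_iff_dense_range_and_antilipschitz _).2 ⟨?_, ⟨c, hc⟩, ?_⟩)
  · have hadj : (B + (Complex.I * s) • P).adjoint = B + (Complex.I * (-s : ℝ)) • P := by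
      simp [map_smulₛₗ, hB.adjoint_eq, hP.isSelfAdjoint.adjoint_eq]
    rw [Submodule.topologicalClosure_eq_top_iff, ContinuousLinearMap.orthogonal_range, hadj,
      LinearMap.ker_eq_bot']
    refine fun u hu => norm_le_zero_iff.1 ((hle' u).trans_eq ?_)
    rw [← ContinuousLinearMap.coe_coe, hu, norm_zero, mul_zero]
  · exact AddMonoidHomClass.antilipschitz_of_bound _ hle

end SelfAdjoint

section SelfadjointFamilies

theorem isFredholm_of_isInvertible {F G : Type*} [NormedAddCommGroup F] [NormedSpace ℂ F]
    [NormedAddCommGroup G] [NormedSpace ℂ G] {A : F →L[ℂ] G} (hA : A.IsInvertible) :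
    A.IsFredholm := by
  obtain ⟨e, rfl⟩ := hA
  exact .of_isQuasiInverse (v := (e.symm : G →L[ℂ] F)) e.toLinearEquiv.isQuasiInverse

theorem index_eq_zero_of_isInvertible {F G : Type*} [NormedAddCommGroup F] [NormedSpace ℂ F]
    [NormedAddCommGroup G] [NormedSpace ℂ G] {A : F →L[ℂ] G} (hA : A.IsInvertible) :
    A.toLinearMap.index = 0 := by
  obtain ⟨e, rfl⟩ := hA
  exact LinearEquiv.index_eq_zero (e := e.toLinearEquiv)

variable {E : Type u} [NormedAddCommGroup E] [InnerProductSpace ℂ E]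

open scoped ComplexOrder in
theorem isPositive_smul_add_smul_id {K : E →L[ℂ] E} (hK : K.IsPositive) (t : unitInterval) :
    ((1 - (t : ℂ)) • K + (t : ℂ) • ContinuousLinearMap.id ℂ E).IsPositive := by
  have h₁ : (0 : ℂ) ≤ 1 - (t : ℂ) := by exact_mod_cast sub_nonneg.2 t.2.2
  have h₀ : (0 : ℂ) ≤ (t : ℂ) := by exact_mod_cast t.2.1
  exact (hK.smul_of_nonneg h₁).add (ContinuousLinearMap.isPositive_id.smul_of_nonneg h₀)

theorem injective_smul_add_smul_id {K : E →L[ℂ] E} (hK : K.IsPositive)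
    (hKinj : Function.Injective K) (t : unitInterval) :
    Function.Injective ((1 - (t : ℂ)) • K + (t : ℂ) • ContinuousLinearMap.id ℂ E) := by
  rcases t.2.1.eq_or_lt with ht | ht
  · simpa [← ht] using hKinj
  rw [injective_iff_map_eq_zero]
  intro u hu
  have hform : (1 - (t : ℝ)) * (inner ℂ u (K u)).re + t * ‖u‖ ^ 2 = 0 := by
    simpa [inner_add_right, inner_smul_right, inner_self_eq_norm_sq_to_K, ← Complex.ofReal_pow,
      ← Complex.ofReal_one, ← Complex.ofReal_sub, Complex.re_ofReal_mul]
      using congrArg (fun w => (inner ℂ u w).re) hu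
  have hKu : 0 ≤ (1 - (t : ℝ)) * (inner ℂ u (K u)).re :=
    mul_nonneg (sub_nonneg.2 t.2.2) (hK.re_inner_nonneg_right u)
  have hu_sq : ‖u‖ ^ 2 = 0 := by
    have : 0 ≤ (t : ℝ) * ‖u‖ ^ 2 := by positivity
    exact (mul_eq_zero.1 (by linarith : (t : ℝ) * ‖u‖ ^ 2 = 0)).resolve_left ht.ne'
  simpa using hu_sq

variable [CompleteSpace E]

theorem isSelfAdjoint_toUnbounded_id_iff {B : E →L[ℂ] E}
    (hk : Function.Injective (ContinuousLinearMap.id ℂ E)) :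
    IsSelfAdjoint (toUnbounded (.id ℂ E) hk B) ↔ IsSelfAdjoint B := by
  refine ⟨fun h => ContinuousLinearMap.isSelfAdjoint_iff_isSymmetric.2 (symm_of_selfadjoint h),
    fun hB => ?_⟩
  have hsymm (u v : E) : inner ℂ (B u) v = inner ℂ u (B v) := hB.isSymmetric u v
  have hdense : Dense ((toUnbounded (.id ℂ E) hk B).domain : Set E) :=
    Function.surjective_id.denseRange
  rw [LinearPMap.isSelfAdjoint_def]
  refine LinearPMap.eq_of_eq_graph ?_
  ext ⟨x, y⟩
  rw [LinearPMap.adjoint_graph_eq_graph_adjoint hdense, Submodule.mem_adjoint_iff,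
    mem_graph_toUnbounded]
  constructor
  · refine fun h => ⟨x, rfl, ext_inner_left ℂ fun w => ?_⟩
    rw [← hsymm]
    exact sub_eq_zero.1 (h w (B w) (mem_graph_toUnbounded.2 ⟨w, rfl, rfl⟩))
  · rintro ⟨_, rfl, rfl⟩ _ _ hw
    obtain ⟨w, rfl, rfl⟩ := mem_graph_toUnbounded.1 hw
    exact sub_eq_zero.2 (hsymm w _)

theorem index_eq_zero_of_isSelfAdjoint {B : E →L[ℂ] E} (hB : IsSelfAdjoint B)
    (hF : B.IsFredholm) : B.toLinearMap.index = 0 :=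
  index_eq_zero_of_selfadjoint
    ((isSelfAdjoint_toUnbounded_id_iff Function.injective_id).2 hB) hF

theorem isFredholmMorphism_add_smul {Z : Type v} [TopologicalSpace Z] {Y : Set Z}
    {A P : Z → E →L[ℂ] E} {s : Z → ℝ} (hA : Continuous A) (hAsa : ∀ z, IsSelfAdjoint (A z))
    (hF : ∀ z, (A z).IsFredholm) (hAY : ∀ z ∈ Y, (A z).IsInvertible) (hP : Continuous P)
    (hPpos : ∀ z, (P z).IsPositive) (hPinj : ∀ z, Function.Injective (P z)) (hs : Continuous s)
    (hs₀ : IsCompact (s ⁻¹' {0})) :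
    IsFredholmMorphism Y fun z => A z + (Complex.I * s z) • P z := by
  have hinv {z : Z} (hz : s z ≠ 0) : (A z + (Complex.I * s z) • P z).IsInvertible :=
    isInvertible_add_smul (hAsa z) (hF z) (hPpos z) (hPinj z) hz
  have hzero {z : Z} (hz : s z = 0) : A z + (Complex.I * s z) • P z = A z := by simp [hz]
  refine ⟨by fun_prop, fun z => ?_, fun z => ?_, ⟨_, hs₀, fun z hz => hinv hz⟩, fun z hz => ?_⟩ <;>
    by_cases hsz : s z = 0
  · simpa only [hzero hsz] using hF z
  · exact isFredholm_of_isInvertible (hinv hsz)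
  · simpa only [hzero hsz] using index_eq_zero_of_isSelfAdjoint (hAsa z) (hF z)
  · exact index_eq_zero_of_isInvertible (hinv hsz)
  · simpa only [hzero hsz] using hAY z hz
  · exact hinv hsz

variable {X : Type v} [TopologicalSpace X] [CompactSpace X] {Y : Set X} {B : X → E →L[ℂ] E}
  {K : E →L[ℂ] E}

theorem isFredholmMorphism_suspension
    (hB : IsSelfadjointFredholmFamily (.id ℂ E) Y B) (hK : K.IsPositive)
    (hKinj : Function.Injective K) : IsFredholmMorphism (Y ×ˢ Set.univ) (suspension K B) :=
  isFredholmMorphism_add_smul (hB.continuous.comp continuous_fst)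
    (fun z => (isSelfAdjoint_toUnbounded_id_iff hB.injective).1 (hB.selfadjoint z.1))
    (fun z => hB.fredholm z.1) (fun z hz => hB.invertible_on z.1 hz.1) continuous_const
    (fun _ => hK) (fun _ => hKinj) continuous_snd
    (Set.univ_prod ▸ isCompact_univ.prod isCompact_singleton)

theorem sind_eq_ind_suspension (hB : IsSelfadjointFredholmFamily (.id ℂ E) Y B)
    (hK : K.IsPositive) (hKinj : Function.Injective K) :
    sind hB = ind (isFredholmMorphism_suspension hB hK hKinj) := by
  let T (p : (X × ℝ) × unitInterval) : E →L[ℂ] E :=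
    B p.1.1 + (Complex.I * (p.1.2 : ℂ)) •
      ((1 - (p.2 : ℂ)) • K + (p.2 : ℂ) • ContinuousLinearMap.id ℂ E)
  have hcompact : IsCompact ((fun p : (X × ℝ) × unitInterval => p.1.2) ⁻¹' {0}) := by
    rw [show (fun p : (X × ℝ) × unitInterval => p.1.2) ⁻¹' {0} =
      (Set.univ ×ˢ {0}) ×ˢ Set.univ by ext; simp]
    exact (isCompact_univ.prod isCompact_singleton).prod isCompact_univ
  have hT : IsFredholmMorphism ((Y ×ˢ Set.univ) ×ˢ Set.univ) T :=
    isFredholmMorphism_add_smul (hB.continuous.comp (by fun_prop))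
      (fun p => (isSelfAdjoint_toUnbounded_id_iff hB.injective).1 (hB.selfadjoint p.1.1))
      (fun p => hB.fredholm p.1.1) (fun p hp => hB.invertible_on p.1.1 hp.1.1) (by fun_prop)
      (fun p => isPositive_smul_add_smul_id hK p.2)
      (fun p => injective_smul_add_smul_id hK hKinj p.2) (by fun_prop) hcompact
  exact (ind_eq_of_homotopy hT _ _ (fun z => by simp [T, suspension])
    (fun z => by simp [T, suspension])).symm

end SelfadjointFamilies

section Comparison

variable {W E H : Type u} [NormedAddCommGroup W] [InnerProductSpace ℂ W]
  [NormedAddCommGroup E] [InnerProductSpace ℂ E] [CompleteSpace E]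
  [NormedAddCommGroup H] [InnerProductSpace ℂ H] [CompleteSpace H]

theorem rieszMap_injective {j : E →L[ℂ] H} (hj : DenseRange j) :
    Function.Injective (rieszMap j) := by
  refine (injective_iff_map_eq_zero _).2 fun u hu => hj.eq_zero_of_inner_left ℂ fun v => ?_
  rw [← inner_rieszMap, hu, inner_zero_left]

theorem denseRange_rieszMap {j : E →L[ℂ] H} (hj : Function.Injective j) :
    DenseRange (rieszMap j) := by
  refine Submodule.dense_iff_topologicalClosure_eq_top.2
    ((rieszMap j).range.topologicalClosure_eq_top_iff.2 ?_)
  rw [ContinuousLinearMap.orthogonal_range, rieszMap, ContinuousLinearMap.adjoint_adjoint]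
  exact LinearMap.ker_eq_bot.2 hj

theorem isInvertible_of_isSelfAdjoint_of_surjective {B : E →L[ℂ] E} (hB : IsSelfAdjoint B)
    (hsurj : Function.Surjective B) : B.IsInvertible := by
  refine isInvertible_of_bijective ⟨LinearMap.ker_eq_bot.1 ?_, hsurj⟩
  rw [← hB.adjoint_eq, ← ContinuousLinearMap.orthogonal_range, LinearMap.range_eq_top.2 hsurj,
    Submodule.top_orthogonal_eq_bot]

section Form

variable {i : W →L[ℂ] E} {j : E →L[ℂ] H} {A : W →L[ℂ] H} {B : E →L[ℂ] E}

theorem isSelfAdjoint_of_form (hi : DenseRange i) {hk : Function.Injective (j ∘L i)}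
    (hA : IsSelfAdjoint (toUnbounded (j ∘L i) hk A))
    (hB : ∀ u v : W, inner ℂ (B (i u)) (i v) = inner ℂ (A u) (j (i v))) : IsSelfAdjoint B := by
  refine ContinuousLinearMap.isSelfAdjoint_iff_isSymmetric.2 fun u v => ?_
  refine hi.induction_on₂ (p := fun u v => inner ℂ (B u) v = inner ℂ u (B v))
    (isClosed_eq (by fun_prop) (by fun_prop)) (fun a b => ?_) u v
  rw [hB, ← inner_conj_symm (i a), hB, inner_conj_symm]
  exact symm_of_selfadjoint hA a b

theorem apply_eq_rieszMap_of_form (hi : DenseRange i)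
    (hB : ∀ u v : W, inner ℂ (B (i u)) (i v) = inner ℂ (A u) (j (i v))) (u : W) :
    B (i u) = rieszMap j (A u) :=
  hi.eq_of_inner_left ℂ fun v => by rw [hB, inner_rieszMap]

end Form

variable {X : Type v} [TopologicalSpace X] {Y : Set X}

theorem isSelfadjointFredholmFamily_of_form {i : W →L[ℂ] E} {j : E →L[ℂ] H}
    (hj : Function.Injective j) (hi : DenseRange i) {D : X → W →L[ℂ] H}
    (hD : IsSelfadjointFredholmFamily (j ∘L i) Y D) {B : X → E →L[ℂ] E}
    (hB : ∀ (x : X) (u v : W), inner ℂ (B x (i u)) (i v) = inner ℂ (D x u) (j (i v)))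
    (hBcont : Continuous B) (hBfred : ∀ x, (B x).IsFredholm) :
    IsSelfadjointFredholmFamily (.id ℂ E) Y B := by
  have hsa (x : X) : IsSelfAdjoint (B x) := isSelfAdjoint_of_form hi (hD.selfadjoint x) (hB x)
  refine ⟨Function.injective_id, Function.surjective_id.denseRange, hBcont,
    fun x => (isSelfAdjoint_toUnbounded_id_iff _).2 (hsa x), hBfred, fun x hx => ?_⟩
  have hrange : (D x).range ⊔ ⊥ = ⊤ := by
    rw [sup_bot_eq, LinearMap.range_eq_top.2 (hD.invertible_on x hx).surjective]
  have hBrange := range_sup_map_eq_top_of_intertwining (denseRange_rieszMap hj)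
    (apply_eq_rieszMap_of_form hi (hB x)) (hBfred x).isClosed_range hrange
  rw [Submodule.map_bot, sup_bot_eq] at hBrange
  exact isInvertible_of_isSelfAdjoint_of_surjective (hsa x) (LinearMap.range_eq_top.1 hBrange)

end Comparison

end IndexBundle

open IndexBundle in
theorem theorem2p3_general {X : Type v} [TopologicalSpace X] [CompactSpace X] {Y : Set X}
    {W E H : Type u} [NormedAddCommGroup W] [InnerProductSpace ℂ W] [CompleteSpace W]
    [NormedAddCommGroup E] [InnerProductSpace ℂ E] [CompleteSpace E]
    [NormedAddCommGroup H] [InnerProductSpace ℂ H] [CompleteSpace H]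
    {i : W →L[ℂ] E} {j : E →L[ℂ] H} (hj : Function.Injective j) (hi : DenseRange i)
    {D : X → W →L[ℂ] H} (hD : IsSelfadjointFredholmFamily (j ∘L i) Y D) {B : X → E →L[ℂ] E}
    (hB : ∀ (x : X) (u v : W), inner ℂ (B x (i u)) (i v) = inner ℂ (D x u) (j (i v)))
    (hBcont : Continuous B) (hBfred : ∀ x, (B x).IsFredholm) :
    ∃ hBfam : IsSelfadjointFredholmFamily (.id ℂ E) Y B, sind hD = sind hBfam := by
  have hBfam := isSelfadjointFredholmFamily_of_form hj hi hD hB hBcont hBfred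
  have hK_inj : Function.Injective (rieszMap j) :=
    rieszMap_injective (hD.denseRange.mono (Set.range_comp_subset_range i j))
  have hK₀ : (rieszMap j ∘L j).IsPositive := ContinuousLinearMap.isPositive_adjoint_comp_self j
  have hK₀_inj : Function.Injective (rieszMap j ∘L j) := hK_inj.comp hj
  refine ⟨hBfam, ?_⟩
  calc sind hD = ind (isFredholmMorphism_suspension hBfam hK₀ hK₀_inj) :=
        ind_eq_of_intertwining _ _ i (rieszMap j) (.of_comp hD.injective) hK_inj
          (denseRange_rieszMap hj) fun z w => by
            simp [suspension, apply_eq_rieszMap_of_form hi (hB z.1)]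
    _ = sind hBfam := (sind_eq_ind_suspension hBfam hK₀ hK₀_inj).symm

theorem theorem2p3
    {X : Type v} [TopologicalSpace X] [CompactSpace X] (Y : Set X) (hY : IsClosed Y)
    {W E H : Type u}
    [NormedAddCommGroup W] [InnerProductSpace ℂ W] [CompleteSpace W]
    [NormedAddCommGroup E] [InnerProductSpace ℂ E] [CompleteSpace E]
    [NormedAddCommGroup H] [InnerProductSpace ℂ H] [CompleteSpace H]
    (i : W →L[ℂ] E) (hi : Function.Injective i)
    (j : E →L[ℂ] H) (hj : Function.Injective j) (hjc : IsCompactOperator j)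
    (hWH : DenseRange (j ∘L i)) (hWE : DenseRange i)
    (hWK : Set.range i ⊆ Set.range (IndexBundle.rieszMap j))
    (D : X → W →L[ℂ] H) (hD : IndexBundle.IsSelfadjointFredholmFamily (j ∘L i) Y D)
    (C : ℝ) (hC : 0 < C)
    (hbound : ∀ (x : X) (u v : W), ‖inner ℂ (D x u) (j (i v))‖ ≤ C * ‖i u‖ * ‖i v‖)
    (B : X → E →L[ℂ] E)
    (hB : ∀ (x : X) (u v : W), inner ℂ (B x (i u)) (i v) = inner ℂ (D x u) (j (i v)))
    (hBcont : Continuous B) (hBfred : ∀ x, (B x).IsFredholm)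
    (hker : ∀ (x : X) (s : ℝ) (u : E),
      B x u + (Complex.I * (s : ℂ)) • IndexBundle.rieszMap j (j u) = 0 → u ∈ Set.range i) :
    ∃ hBfam : IndexBundle.IsSelfadjointFredholmFamily (ContinuousLinearMap.id ℂ E) Y B,
      IndexBundle.sind hD = IndexBundle.sind hBfam :=
  theorem2p3_general hj hWE hD hB hBcont hBfred
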